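/- Let $0<s<1$, let $N\ge 1$ be an integer with $N>2s$, and let $\Omega\subset\mathbb R^N$ be a bounded smooth domain (open, connected) with $0\in\Omega$. Let $f:\Omega\times[0,\infty)\to\mathbb R$ and $g:[0,\infty)\to[0,\infty)$ satisfy $(H_1)$: $f$ is a Carathéodory function and for every $M>0$ there are constants $L_f(M),L_g(M)$ such that $|f(x,t_1)-f(x,t_2)|\le L_f(M)|t_1-t_2|$ and $|g(t_1)-g(t_2)|\le L_g(M)|t_1-t_2|$ for all $x\in\Omega$ and $t_1,t_2\in[0,M]$. Assume moreover that $t\mapsto f(x,t)$ is nondecreasing for every $x\in\Omega$ and that $g$ is nondecreasing. Let $H^s_0(\Omega)=\{v\in H^s(\mathbb R^N): v=0 \text{ in }\mathbb R^N\setminus\Omega\}$ and $c_{N,s}=\dfrac{4^s\,\Gamma(\frac N2+s)}{-\pi^{N/2}\,\Gamma(-s)}>0$. A weak solution of $$(-\Delta)^su=\frac{g(u)}{|x|^{2s}}+f(x,u)\ \text{ in }\Omega,\qquad u>0\ \text{ in }\Omega,\qquad u=0\ \text{ in }\mathbb R^N\setminus\Omega \qquad (P)$$ is a function $u\in H^s_0(\Omega)$,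 positive in $\Omega\setminus\{0\}$ and zero in $\mathbb R^N\setminus\Omega$, with $g(u)/|x|^{2s}\in L^1(\Omega)$, $f(x,u)\in L^1(\Omega)$ and $$\frac{c_{N,s}}2\iint_{\mathbb R^{2N}\setminus(\Omega^c\times\Omega^c)}\frac{(u(x)-u(y))(\varphi(x)-\varphi(y))}{|x-y|^{N+2s}}\,dx\,dy=\int_\Omega\frac{g(u)}{|x|^{2s}}\varphi\,dx+\int_\Omega f(x,u)\varphi\,dx$$ for all $\varphi\in H^s_0(\Omega)\cap L^\infty(\Omega)$. For $\nu\in\mathbb R^N$ with $|\nu|=1$ and $\lambda\in\mathbb R$ put $\Omega^\nu_\lambda=\{x\in\Omega: x\cdot\nu<\lambda\}$, $x^\nu_\lambda=R^\nu_\lambda(x)=x+2(\lambda-x\cdot\nu)\nu$, $u^\nu_\lambda(x)=u(x^\nu_\lambda)$, $a(\nu)=\inf_{x\in\Omega}x\cdot\nu$, $$\lambda_1(\nu)=\sup\{\lambda: R^\nu_\mu(\Omega^\nu_\mu)\subset\Omega\ \text{ for all } \mu\le\lambda\},\qquad \lambda_1^0(\nu)=\min\{0,\lambda_1(\nu)\}.$$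 Fix such a $\nu$ and assume that $$f(x,t)\le f(x^\nu_\lambda,t)\qquad\text{for all }\lambda\le\lambda^0_1(\nu),\ x\in\Omega^\nu_\lambda,\ t\in[0,\infty).$$ Let $u\in C^0(\overline\Omega\setminus\{0\})$ be a weak solution of $(P)$. Then, for every $\lambda$ with $a(\nu)\le\lambda\le\lambda_1^0(\nu)$, $$u(x)\le u^\nu_\lambda(x)\qquad\text{for all }x\in\Omega^\nu_\lambda \text{ with } x^\nu_\lambda\ne0,$$ and $u$ is strictly increasing in the $\nu$-direction in $\Omega^\nu_\lambda$, i.e. $u(x)<u(x+h\nu)$ whenever $h>0$ and $x,\,x+h\nu\in\Omega^\nu_\lambda$. -/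

import Mathlib

open MeasureTheory Set
open scoped ContDiff ENNReal

noncomputable section

namespace FractionalHardy

/-- Euclidean space `ℝ^N`. -/
abbrev E (N : ℕ) : Type := EuclideanSpace ℝ (Fin N)

/-- A bounded smooth domain: a bounded, open, connected, nonempty set which near each of its
boundary points is the sublevel set `{ρ < 0}` of a smooth function with nonvanishing gradient. -/
structure IsBoundedSmoothDomain {N : ℕ} (Ω : Set (E N)) : Prop where
  isOpen : IsOpen Ω
  isConnected : IsConnected Ω
  isBounded : Bornology.IsBounded Ω
  smooth_boundary : ∀ p ∈ frontier Ω, ∃ (U : Set (E N)) (ρ : E N → ℝ),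
    IsOpen U ∧ p ∈ U ∧ ContDiffOn ℝ ∞ ρ U ∧ (∀ x ∈ U, fderiv ℝ ρ x ≠ 0) ∧
      Ω ∩ U = {x ∈ U | ρ x < 0}

/-- The normalizing constant
`c_{N,s} = (∫ (1 - cos ξ₁) / |ξ|^(N+2s) dξ)⁻¹ = 4^s Γ(N/2 + s) / (- π^(N/2) Γ(-s))`. -/
def fracConst (N : ℕ) (s : ℝ) : ℝ :=
  (4 : ℝ) ^ s * Real.Gamma ((N : ℝ) / 2 + s) / (-(Real.pi ^ ((N : ℝ) / 2) * Real.Gamma (-s)))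

/-- `u ∈ H^s(ℝ^N)`: `u` is square integrable with finite Gagliardo seminorm. -/
structure MemHs {N : ℕ} (s : ℝ) (u : E N → ℝ) : Prop where
  memLp : MemLp u 2 volume
  gagliardo : Integrable
    (fun z : E N × E N => (u z.1 - u z.2) ^ 2 / ‖z.1 - z.2‖ ^ ((N : ℝ) + 2 * s)) volume

/-- `u ∈ H^s_0(Ω)`: `u ∈ H^s(ℝ^N)` and `u = 0` almost everywhere in `ℝ^N ∖ Ω`. -/
structure MemHs0 {N : ℕ} (s : ℝ) (Ω : Set (E N)) (u : E N → ℝ) : Prop where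
  memHs : MemHs s u
  ae_zero : ∀ᵐ x, x ∉ Ω → u x = 0

/-- Weak (energy) solutions `u` of
`(-Δ)^s u = g(u)/|x|^(2s) + f(x,u)` in `Ω`, `u > 0` in `Ω`, `u = 0` in `ℝ^N ∖ Ω`.
Nothing is required of the value of `u` at the pole `0`, where `u` may be singular. -/
structure IsWeakSolution {N : ℕ} (s : ℝ) (Ω : Set (E N)) (f : E N → ℝ → ℝ) (g : ℝ → ℝ)
    (u : E N → ℝ) : Prop where
  memHs0 : MemHs0 s Ω u
  pos : ∀ x ∈ Ω, x ≠ 0 → 0 < u x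
  zero_outside : ∀ x, x ∉ Ω → u x = 0
  integrable_g : IntegrableOn (fun x => g (u x) / ‖x‖ ^ (2 * s)) Ω volume
  integrable_f : IntegrableOn (fun x => f x (u x)) Ω volume
  weak_eq : ∀ φ : E N → ℝ, MemHs0 s Ω φ → MemLp φ ∞ (volume.restrict Ω) →
    (1 / 2) * fracConst N s *
        (∫ z in (Ωᶜ ×ˢ Ωᶜ)ᶜ,
          (u z.1 - u z.2) * (φ z.1 - φ z.2) / ‖z.1 - z.2‖ ^ ((N : ℝ) + 2 * s)) =
      (∫ x in Ω, g (u x) / ‖x‖ ^ (2 * s) * φ x) + ∫ x in Ω, f x (u x) * φ x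

/-- Hypothesis `(H_1)`: `f : Ω × [0,∞) → ℝ` is a Carathéodory function which is Lipschitz in the
second variable on bounded intervals, uniformly in `x ∈ Ω`, and `g : [0,∞) → ℝ` is Lipschitz on
bounded intervals. Values of `f` and `g` outside these domains are irrelevant. -/
structure HypH1 {N : ℕ} (Ω : Set (E N)) (f : E N → ℝ → ℝ) (g : ℝ → ℝ) : Prop where
  measurable_f : ∀ t : ℝ, 0 ≤ t → AEStronglyMeasurable (fun x => f x t) (volume.restrict Ω)
  continuous_f : ∀ᵐ x ∂(volume.restrict Ω), ContinuousOn (f x) (Ici 0)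
  lipschitz_f : ∀ M : ℝ, 0 < M → ∃ L : ℝ, ∀ x ∈ Ω, ∀ t₁ ∈ Icc 0 M, ∀ t₂ ∈ Icc 0 M,
    |f x t₁ - f x t₂| ≤ L * |t₁ - t₂|
  lipschitz_g : ∀ M : ℝ, 0 < M → ∃ L : ℝ, ∀ t₁ ∈ Icc 0 M, ∀ t₂ ∈ Icc 0 M,
    |g t₁ - g t₂| ≤ L * |t₁ - t₂|

/-- The cap `Ω_l^ν = {x ∈ Ω : x·ν < l}`. -/
def cap {N : ℕ} (Ω : Set (E N)) (ν : E N) (l : ℝ) : Set (E N) :=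
  {x ∈ Ω | inner ℝ x ν < l}

/-- The reflection `x_l^ν = x + 2 (l - x·ν) ν` through the hyperplane `{x·ν = l}`. -/
def reflect {N : ℕ} (ν : E N) (l : ℝ) (x : E N) : E N :=
  x + (2 * (l - inner ℝ x ν)) • ν

/-- `a(ν) = inf_{x ∈ Ω} x·ν`. -/
def aInf {N : ℕ} (Ω : Set (E N)) (ν : E N) : ℝ :=
  sInf ((fun x => inner ℝ x ν) '' Ω)

/-- `λ_1(ν)`: the supremum of the `l` such that all caps up to `l` are reflected into `Ω`.
(For `m ≤ a(ν)` the cap is empty, so that only `a(ν) < m ≤ l` matters.) -/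
def lambda1 {N : ℕ} (Ω : Set (E N)) (ν : E N) : ℝ :=
  sSup {l : ℝ | ∀ m ≤ l, reflect ν m '' cap Ω ν m ⊆ Ω}

/-- `λ_1^0(ν) = min {0, λ_1(ν)}`. -/
def lambda10 {N : ℕ} (Ω : Set (E N)) (ν : E N) : ℝ :=
  min 0 (lambda1 Ω ν)

end FractionalHardy

end

open FractionalHardy

open MeasureTheory Set
open scoped ContDiff ENNReal

noncomputable section

namespace FractionalHardy

/-! This is the method of moving planes in weak form. Put v = u - u∘R_l, which is antisymmetric
under the reflection R_l, and test with φ, the positive part of v on the half-space x·ν ≤ l extended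
by zero (`halfPos`). Antisymmetry makes φ admissible (`MemHs.halfPos`) and bounds its energy by the
form evaluated at (v, φ) (`gagliardoForm_halfPos_self_le`). On the other side of the equation, for l
< 0 reflection brings a point of the cap closer to the pole, so the Hardy weight and the hypothesis
on f both have the favourable sign. What remains is a Lipschitz term C·v, because u is bounded on
caps that stay away from the pole. If v ≤ 0 in the cap outside a set of small measure, a Poincaré
inequality absorbs this term and v ≤ 0 throughout the cap (`exists_belowReflection_of_small`).

Strict inequality (`lt_reflect_of_belowReflection`) comes from nonlocality. For l < λ₁ some ball
below Ω is mapped by R_l to where u > 0, so v is negative on that ball. This gives the form a gain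
proportional to ∫φ, which outweighs the cost of a small barrier added to v.

The plane then moves. The levels in [a(ν), l₀] with v ≤ 0 form a closed set containing a(ν), where
the cap is empty. Strictness on a large compact set, together with the small-measure principle,
makes this set open to the right. The level λ₁⁰ itself is reached by continuity. Monotonicity
follows because x + hν is the reflection of x in the hyperplane halfway between them. -/

variable {N : ℕ} {s : ℝ}

/-! ### Reflections in hyperplanes. -/

section Reflection

variable {ν : E N} {l : ℝ}

lemma inner_reflect (hν : ‖ν‖ = 1) (l : ℝ) (x : E N) :
    inner ℝ (reflect ν l x) ν = 2 * l - inner ℝ x ν := by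
  rw [reflect, inner_add_left, inner_smul_left, real_inner_self_eq_norm_sq, hν]
  simp
  ring

lemma reflect_reflect (hν : ‖ν‖ = 1) (l : ℝ) (x : E N) :
    reflect ν l (reflect ν l x) = x := by
  rw [reflect, inner_reflect hν, reflect, add_assoc, ← add_smul]
  ring_nf
  simp

/-- All kernel comparisons rest on this identity: the last term is nonnegative when x and y lie on
the same side of the hyperplane. -/
lemma norm_sub_reflect_sq (hν : ‖ν‖ = 1) (l : ℝ) (x y : E N) :
    ‖x - reflect ν l y‖ ^ 2 =
      ‖x - y‖ ^ 2 + 4 * ((l - inner ℝ x ν) * (l - inner ℝ y ν)) := by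
  have h : x - reflect ν l y = (x - y) - (2 * (l - inner ℝ y ν)) • ν := by
    rw [reflect]; abel
  rw [h, norm_sub_sq_real, norm_smul, hν, inner_smul_right, inner_sub_left, mul_one,
    Real.norm_eq_abs, sq_abs]
  ring

lemma norm_reflect_sub_reflect (hν : ‖ν‖ = 1) (l : ℝ) (x y : E N) :
    ‖reflect ν l x - reflect ν l y‖ = ‖x - y‖ := by
  rw [← sq_eq_sq₀ (norm_nonneg _) (norm_nonneg _), norm_sub_reflect_sq hν, norm_sub_rev,
    norm_sub_reflect_sq hν, inner_reflect hν, norm_sub_rev]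
  ring

lemma norm_reflect_sub (hν : ‖ν‖ = 1) (l : ℝ) (x y : E N) :
    ‖reflect ν l x - y‖ = ‖x - reflect ν l y‖ := by
  rw [← norm_reflect_sub_reflect hν l x, reflect_reflect hν]

lemma norm_reflect_sq (hν : ‖ν‖ = 1) (l : ℝ) (x : E N) :
    ‖reflect ν l x‖ ^ 2 = ‖x‖ ^ 2 + 4 * (l * (l - inner ℝ x ν)) := by
  have := norm_sub_reflect_sq hν l 0 x
  simpa using this

lemma norm_sub_le_norm_sub_reflect (hν : ‖ν‖ = 1) {x y : E N}
    (hx : inner ℝ x ν ≤ l) (hy : inner ℝ y ν ≤ l) : ‖x - y‖ ≤ ‖x - reflect ν l y‖ := by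
  rw [← sq_le_sq₀ (norm_nonneg _) (norm_nonneg _), norm_sub_reflect_sq hν]
  have := mul_nonneg (sub_nonneg.2 hx) (sub_nonneg.2 hy)
  linarith

lemma norm_sub_lt_norm_sub_reflect (hν : ‖ν‖ = 1) {x y : E N}
    (hx : inner ℝ x ν < l) (hy : inner ℝ y ν < l) : ‖x - y‖ < ‖x - reflect ν l y‖ := by
  rw [← sq_lt_sq₀ (norm_nonneg _) (norm_nonneg _), norm_sub_reflect_sq hν]
  have := mul_pos (sub_pos.2 hx) (sub_pos.2 hy)
  linarith

lemma reflect_eq_self {x : E N} (hx : inner ℝ x ν = l) : reflect ν l x = x := by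
  simp [reflect, hx]

lemma continuous_reflect : Continuous (fun p : ℝ × E N => reflect ν p.1 p.2) := by
  unfold reflect; fun_prop

lemma continuous_reflect_right (l : ℝ) : Continuous (reflect ν l) :=
  continuous_reflect.comp (Continuous.prodMk_right l)

lemma measurePreserving_reflect (hν : ‖ν‖ = 1) (l : ℝ) :
    MeasurePreserving (reflect ν l) (volume : Measure (E N)) volume := by
  have h := (measurePreserving_add_right (volume : Measure (E N)) ((2 * l) • ν)).comp
    (Submodule.reflection (Submodule.span ℝ {ν})ᗮ).measurePreserving
  have he : reflect ν l = (fun x => x + (2 * l) • ν) ∘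
      (Submodule.reflection (Submodule.span ℝ {ν})ᗮ) := by
    funext x
    simp only [Function.comp, Submodule.reflection_orthogonal_apply,
      Submodule.reflection_singleton_apply, hν, reflect]
    rw [real_inner_comm]
    simp only [RCLike.ofReal_real_eq_id, id, one_pow, div_one, mul_sub, sub_smul, mul_smul]
    simp only [two_smul, neg_sub]
    abel
  rw [he]
  exact h

lemma measurable_reflect (l : ℝ) : Measurable (reflect ν l) :=
  (continuous_reflect_right l).measurable

lemma measurableEmbedding_reflect (hν : ‖ν‖ = 1) (l : ℝ) :
    MeasurableEmbedding (reflect ν l) :=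
  (continuous_reflect_right l).measurableEmbedding
    (Function.LeftInverse.injective (reflect_reflect hν l))

lemma integral_comp_reflect (hν : ‖ν‖ = 1) (l : ℝ) (F : E N → ℝ) :
    ∫ x, F (reflect ν l x) = ∫ x, F x :=
  (measurePreserving_reflect hν l).integral_comp (measurableEmbedding_reflect hν l) F

lemma measurePreserving_prodMap_reflect (hν : ‖ν‖ = 1) (l : ℝ) :
    MeasurePreserving (Prod.map (reflect ν l) (reflect ν l))
      (volume : Measure (E N × E N)) volume :=
  (measurePreserving_reflect hν l).prod (measurePreserving_reflect hν l)

lemma measurePreserving_prodMap_id_reflect (hν : ‖ν‖ = 1) (l : ℝ) :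
    MeasurePreserving (Prod.map id (reflect ν l))
      (volume : Measure (E N × E N)) volume :=
  (MeasurePreserving.id _).prod (measurePreserving_reflect hν l)

lemma measurePreserving_prodMap_reflect_id (hν : ‖ν‖ = 1) (l : ℝ) :
    MeasurePreserving (Prod.map (reflect ν l) id)
      (volume : Measure (E N × E N)) volume :=
  (measurePreserving_reflect hν l).prod (MeasurePreserving.id _)

lemma measurableEmbedding_prodMap_of_involutive {R S : E N → E N} (hR : Measurable R)
    (hS : Measurable S) (hRR : ∀ x, R (R x) = x) (hSS : ∀ x, S (S x) = x) :
    MeasurableEmbedding (Prod.map R S) :=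
  (MeasurableEquiv.mk ⟨Prod.map R S, Prod.map R S, fun z => by simp [Prod.map, hRR, hSS],
    fun z => by simp [Prod.map, hRR, hSS]⟩ (hR.prodMap hS) (hR.prodMap hS)).measurableEmbedding

/-- Two integrals over `ℝ^N × ℝ^N` compare as soon as the integrands do after summation over
the orbits of the reflections of the two factors. -/
lemma integral_le_integral_of_sum_reflect_le (hν : ‖ν‖ = 1) (l : ℝ) {F G : E N × E N → ℝ}
    (hF : Integrable F) (hG : Integrable G)
    (h : ∀ x y, inner ℝ x ν ≤ l → inner ℝ y ν ≤ l →
      G (x, y) + G (x, reflect ν l y) + G (reflect ν l x, y) + G (reflect ν l x, reflect ν l y) ≤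
      F (x, y) + F (x, reflect ν l y) + F (reflect ν l x, y) +
        F (reflect ν l x, reflect ν l y)) :
    ∫ z, G z ≤ ∫ z, F z := by
  -- Orbit sums do not change when a point is replaced by its reflection, so the hypothesis on the
  -- half-space covers all pairs.
  have hall : ∀ x y,
      G (x, y) + G (x, reflect ν l y) + G (reflect ν l x, y) + G (reflect ν l x, reflect ν l y) ≤
      F (x, y) + F (x, reflect ν l y) + F (reflect ν l x, y) +
        F (reflect ν l x, reflect ν l y) := by
    intro x y
    have hR : ∀ x : E N, ¬ inner ℝ x ν ≤ l → inner ℝ (reflect ν l x) ν ≤ l := by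
      intro x hx
      rw [inner_reflect hν]; linarith [not_le.1 hx]
    by_cases hx : inner ℝ x ν ≤ l <;> by_cases hy : inner ℝ y ν ≤ l
    · exact h x y hx hy
    · have := h x _ hx (hR y hy)
      rw [reflect_reflect hν] at this
      linarith
    · have := h _ y (hR x hx) hy
      rw [reflect_reflect hν] at this
      linarith
    · have := h _ _ (hR x hx) (hR y hy)
      rw [reflect_reflect hν, reflect_reflect hν] at this
      linarith
  have m₁ := measurePreserving_prodMap_id_reflect hν l
  have m₂ := measurePreserving_prodMap_reflect_id hν l
  have m₃ := measurePreserving_prodMap_reflect hν l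
  have hm := measurable_reflect (ν := ν) l
  have hr := reflect_reflect hν l
  have e₁ := measurableEmbedding_prodMap_of_involutive measurable_id hm (fun _ => rfl) hr
  have e₂ := measurableEmbedding_prodMap_of_involutive hm measurable_id hr (fun _ => rfl)
  have e₃ := measurableEmbedding_prodMap_of_involutive hm hm hr hr
  have key : ∀ {J : E N × E N → ℝ}, Integrable J →
      Integrable (fun z : E N × E N => J (z.1, z.2) + J (z.1, reflect ν l z.2) +
        J (reflect ν l z.1, z.2) + J (reflect ν l z.1, reflect ν l z.2)) ∧
      ∫ z : E N × E N, (J (z.1, z.2) + J (z.1, reflect ν l z.2) +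
        J (reflect ν l z.1, z.2) + J (reflect ν l z.1, reflect ν l z.2)) = 4 * ∫ z, J z := by
    intro J hJ
    have i₁ := m₁.integrable_comp_of_integrable hJ
    have i₂ := m₂.integrable_comp_of_integrable hJ
    have i₃ := m₃.integrable_comp_of_integrable hJ
    refine ⟨((hJ.add i₁).add i₂).add i₃, ?_⟩
    have a₁ := m₁.integral_comp e₁ J
    have a₂ := m₂.integral_comp e₂ J
    have a₃ := m₃.integral_comp e₃ J
    have h₃ := integral_add ((hJ.add i₁).add i₂) i₃
    have h₂ := integral_add (hJ.add i₁) i₂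
    have h₁ := integral_add hJ i₁
    simp only [Pi.add_apply, Function.comp, Prod.map, id] at a₁ a₂ a₃ h₁ h₂ h₃
    rw [h₃, h₂, h₁, a₁, a₂, a₃]
    ring
  obtain ⟨hGi, hGe⟩ := key hG
  obtain ⟨hFi, hFe⟩ := key hF
  have := integral_mono hGi hFi fun z => hall z.1 z.2
  rw [hGe, hFe] at this
  linarith

end Reflection

/-! ### The space H^s and its bilinear form. -/

section Sobolev

/-- The bilinear form `∬ (v(x) - v(y)) (φ(x) - φ(y)) / |x - y|^(N+2s) dx dy`. -/
def gagliardoForm (s : ℝ) (v φ : E N → ℝ) : ℝ :=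
  ∫ z : E N × E N, (v z.1 - v z.2) * (φ z.1 - φ z.2) / ‖z.1 - z.2‖ ^ ((N : ℝ) + 2 * s)

lemma aestronglyMeasurable_gagliardo {v φ : E N → ℝ} (hv : AEStronglyMeasurable v volume)
    (hφ : AEStronglyMeasurable φ volume) (p : ℝ) :
    AEStronglyMeasurable
      (fun z : E N × E N => (v z.1 - v z.2) * (φ z.1 - φ z.2) / ‖z.1 - z.2‖ ^ p) volume := by
  have hK : Measurable fun z : E N × E N => ‖z.1 - z.2‖ ^ p := by fun_prop
  have hd : ∀ {w : E N → ℝ}, AEStronglyMeasurable w volume →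
      AEStronglyMeasurable (fun z : E N × E N => w z.1 - w z.2) volume :=
    fun hw => hw.comp_fst.sub hw.comp_snd
  exact (((hd hv).mul (hd hφ)).aemeasurable.div hK.aemeasurable).aestronglyMeasurable

lemma aestronglyMeasurable_gagliardo_sq {v : E N → ℝ} (hv : AEStronglyMeasurable v volume)
    (p : ℝ) : AEStronglyMeasurable
      (fun z : E N × E N => (v z.1 - v z.2) ^ 2 / ‖z.1 - z.2‖ ^ p) volume := by
  simpa only [sq] using aestronglyMeasurable_gagliardo hv hv p

namespace MemHs

variable {u v φ : E N → ℝ}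

lemma aestronglyMeasurable (hu : MemHs s u) : AEStronglyMeasurable u volume :=
  hu.memLp.aestronglyMeasurable

lemma of_le (hu : MemLp u 2 volume) {D : E N × E N → ℝ} (hD : Integrable D)
    (h : ∀ z : E N × E N, (u z.1 - u z.2) ^ 2 / ‖z.1 - z.2‖ ^ ((N : ℝ) + 2 * s) ≤ D z) :
    MemHs s u := by
  refine ⟨hu, hD.mono' (aestronglyMeasurable_gagliardo_sq hu.aestronglyMeasurable _) ?_⟩
  refine Filter.Eventually.of_forall fun z => ?_
  rw [Real.norm_of_nonneg (by positivity)]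
  exact h z

lemma integrable_form (hv : MemHs s v) (hφ : MemHs s φ) :
    Integrable (fun z : E N × E N =>
      (v z.1 - v z.2) * (φ z.1 - φ z.2) / ‖z.1 - z.2‖ ^ ((N : ℝ) + 2 * s)) volume := by
  refine (hv.gagliardo.add hφ.gagliardo).mono'
    (aestronglyMeasurable_gagliardo hv.aestronglyMeasurable hφ.aestronglyMeasurable _) ?_
  refine Filter.Eventually.of_forall fun z => ?_
  have hK : 0 ≤ ‖z.1 - z.2‖ ^ ((N : ℝ) + 2 * s) := by positivity
  rw [Real.norm_eq_abs, abs_div, abs_of_nonneg hK, Pi.add_apply, ← add_div]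
  gcongr
  rw [abs_le]
  constructor <;> nlinarith [sq_nonneg ((v z.1 - v z.2) + (φ z.1 - φ z.2)),
    sq_nonneg ((v z.1 - v z.2) - (φ z.1 - φ z.2)), sq_nonneg (v z.1 - v z.2),
    sq_nonneg (φ z.1 - φ z.2)]

lemma add (hu : MemHs s u) (hv : MemHs s v) : MemHs s (fun x => u x + v x) := by
  refine of_le (hu.memLp.add hv.memLp)
    ((hu.gagliardo.const_mul 2).add (hv.gagliardo.const_mul 2)) fun z => ?_
  simp only [Pi.add_apply, ← mul_div_assoc, ← add_div]
  gcongr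
  nlinarith [sq_nonneg ((u z.1 - u z.2) - (v z.1 - v z.2))]

lemma const_mul (hu : MemHs s u) (c : ℝ) : MemHs s (fun x => c * u x) := by
  refine of_le (hu.memLp.const_mul c) (hu.gagliardo.const_mul (c ^ 2)) fun z => ?_
  simp only [← mul_div_assoc]
  exact le_of_eq (by ring)

lemma sub (hu : MemHs s u) (hv : MemHs s v) : MemHs s (fun x => u x - v x) := by
  simpa [sub_eq_add_neg] using hu.add (hv.const_mul (-1))

lemma comp_reflect (hu : MemHs s u) {ν : E N} (hν : ‖ν‖ = 1) (l : ℝ) :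
    MemHs s (fun x => u (reflect ν l x)) := by
  refine of_le (hu.memLp.comp_measurePreserving (measurePreserving_reflect hν l))
    ((measurePreserving_prodMap_reflect hν l).integrable_comp_of_integrable hu.gagliardo)
    fun z => ?_
  simp only [Function.comp, Prod.map]
  rw [norm_reflect_sub_reflect hν]

end MemHs

lemma gagliardoForm_add_left {u v φ : E N → ℝ} (hu : MemHs s u) (hv : MemHs s v)
    (hφ : MemHs s φ) :
    gagliardoForm s (fun x => u x + v x) φ = gagliardoForm s u φ + gagliardoForm s v φ := by
  rw [gagliardoForm, gagliardoForm, gagliardoForm,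
    ← integral_add (hu.integrable_form hφ) (hv.integrable_form hφ)]
  congr 1; ext z; ring

lemma gagliardoForm_const_mul_left (u φ : E N → ℝ) (c : ℝ) :
    gagliardoForm s (fun x => c * u x) φ = c * gagliardoForm s u φ := by
  rw [gagliardoForm, gagliardoForm, ← integral_const_mul]
  congr 1; ext z; ring

lemma gagliardoForm_sub_left {u v φ : E N → ℝ} (hu : MemHs s u) (hv : MemHs s v)
    (hφ : MemHs s φ) :
    gagliardoForm s (fun x => u x - v x) φ = gagliardoForm s u φ - gagliardoForm s v φ := by
  rw [gagliardoForm, gagliardoForm, gagliardoForm,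
    ← integral_sub (hu.integrable_form hφ) (hv.integrable_form hφ)]
  congr 1; ext z; ring

lemma gagliardoForm_reflect {ν : E N} (hν : ‖ν‖ = 1) (l : ℝ) (u φ : E N → ℝ) :
    gagliardoForm s u (fun x => φ (reflect ν l x)) =
      gagliardoForm s (fun x => u (reflect ν l x)) φ := by
  have hm := measurable_reflect (ν := ν) l
  have hr := reflect_reflect hν l
  rw [gagliardoForm, gagliardoForm, ← (measurePreserving_prodMap_reflect hν l).integral_comp
    (measurableEmbedding_prodMap_of_involutive hm hm hr hr)]
  simp only [Prod.map, hr, norm_reflect_sub_reflect hν]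

end Sobolev

/-! ### Positive parts of antisymmetric functions in a half-space. -/

section PosPart

variable {ν : E N} {l : ℝ} {ψ : E N → ℝ}

/-- The positive part of `ψ` in the half space `{x·ν ≤ l}`, extended by zero. -/
def halfPos (ν : E N) (l : ℝ) (ψ : E N → ℝ) (x : E N) : ℝ :=
  if inner ℝ x ν ≤ l then max (ψ x) 0 else 0

lemma halfPos_of_le {x : E N} (hx : inner ℝ x ν ≤ l) : halfPos ν l ψ x = max (ψ x) 0 :=
  if_pos hx

lemma halfPos_of_lt {x : E N} (hx : l < inner ℝ x ν) : halfPos ν l ψ x = 0 :=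
  if_neg (not_le.2 hx)

lemma halfPos_nonneg (x : E N) : 0 ≤ halfPos ν l ψ x := by
  unfold halfPos; split_ifs <;> simp

lemma halfPos_reflect (hν : ‖ν‖ = 1) (hψ : ∀ x, ψ (reflect ν l x) = - ψ x) {x : E N}
    (hx : inner ℝ x ν ≤ l) : halfPos ν l ψ (reflect ν l x) = 0 := by
  rcases hx.eq_or_lt with hx | hx
  · have h := hψ x
    rw [reflect_eq_self hx] at h
    rw [reflect_eq_self hx, halfPos_of_le hx.le, max_eq_right (by linarith)]
  · exact halfPos_of_lt (by rw [inner_reflect hν]; linarith)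

lemma aestronglyMeasurable_halfPos (hψ : AEStronglyMeasurable ψ volume) :
    AEStronglyMeasurable (halfPos ν l ψ) volume := by
  have hm : MeasurableSet {x : E N | inner ℝ x ν ≤ l} :=
    (isClosed_le (by fun_prop) continuous_const).measurableSet
  have : halfPos ν l ψ = {x : E N | inner ℝ x ν ≤ l}.indicator (fun x => max (ψ x) 0) := by
    funext x
    simp [halfPos, indicator]
  rw [this]
  exact (hψ.sup aestronglyMeasurable_const).indicator hm

lemma inv_rpow_norm_sub_reflect_le (hs : 0 < s) (hν : ‖ν‖ = 1) {x y : E N} (hxy : x ≠ y)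
    (hx : inner ℝ x ν ≤ l) (hy : inner ℝ y ν ≤ l) :
    (‖x - reflect ν l y‖ ^ ((N : ℝ) + 2 * s))⁻¹ ≤ (‖x - y‖ ^ ((N : ℝ) + 2 * s))⁻¹ := by
  have h : 0 < ‖x - y‖ := norm_pos_iff.2 (sub_ne_zero.2 hxy)
  have := norm_sub_le_norm_sub_reflect hν hx hy
  gcongr

/-- Used with p = ψ x and q = ψ y. The clause `p ≠ -q` rules out x = R y, where the inverse kernel
takes the default value 0 and the comparison of kernels would fail. -/
lemma sq_max_le_of_sign (p q : ℝ) :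
    (max p 0) ^ 2 ≤ (p - q) ^ 2 ∨ ((max p 0) ^ 2 ≤ (p + q) ^ 2 ∧ p ≠ -q) := by
  rcases le_total p 0 with hp | hp
  · left; rw [max_eq_right hp]; nlinarith [sq_nonneg (p - q)]
  · rw [max_eq_left hp]
    rcases le_or_gt q 0 with hq | hq
    · left; nlinarith [mul_nonneg hp (neg_nonneg.2 hq)]
    · right
      exact ⟨by nlinarith [mul_nonneg hp hq.le], by intro h; linarith⟩

/-- Extension by zero across a hyperplane need not preserve H^s. Antisymmetry helps: for a pair
separated by the hyperplane, the difference is controlled either by the same pair or by the closer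
pair obtained by reflecting one point, at which ψ changes sign. -/
lemma MemHs.halfPos (hs : 0 < s) (hν : ‖ν‖ = 1) (h : MemHs s ψ)
    (hψ : ∀ x, ψ (reflect ν l x) = - ψ x) : MemHs s (halfPos ν l ψ) := by
  have hmem : MemLp (FractionalHardy.halfPos ν l ψ) 2 volume := by
    refine h.memLp.mono (aestronglyMeasurable_halfPos h.aestronglyMeasurable)
      (Filter.Eventually.of_forall fun x => ?_)
    rw [Real.norm_of_nonneg (halfPos_nonneg x), Real.norm_eq_abs]
    unfold FractionalHardy.halfPos
    split_ifs
    · exact max_le (le_abs_self _) (abs_nonneg _)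
    · exact abs_nonneg _
  refine of_le hmem (h.gagliardo.add
    ((measurePreserving_prodMap_id_reflect hν l).integrable_comp_of_integrable h.gagliardo))
    fun z => ?_
  obtain ⟨x, y⟩ := z
  simp only [Pi.add_apply, Function.comp, Prod.map, id, hψ]
  have n₁ : 0 ≤ (ψ x - ψ y) ^ 2 / ‖x - y‖ ^ ((N : ℝ) + 2 * s) := by positivity
  have n₂ : 0 ≤ (ψ x - -ψ y) ^ 2 / ‖x - reflect ν l y‖ ^ ((N : ℝ) + 2 * s) := by positivity
  have hRle : ∀ {w : E N}, l < inner ℝ w ν → inner ℝ (reflect ν l w) ν ≤ l := by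
    intro w hw
    rw [inner_reflect hν]; linarith
  have hK : 0 ≤ (‖x - y‖ ^ ((N : ℝ) + 2 * s))⁻¹ := by positivity
  have fin : ∀ t : ℝ, 0 ≤ t → (t ≤ (ψ x - ψ y) ^ 2 ∨ (t ≤ (ψ x + ψ y) ^ 2 ∧
      (‖x - y‖ ^ ((N : ℝ) + 2 * s))⁻¹ ≤ (‖x - reflect ν l y‖ ^ ((N : ℝ) + 2 * s))⁻¹)) →
      t / ‖x - y‖ ^ ((N : ℝ) + 2 * s) ≤ (ψ x - ψ y) ^ 2 / ‖x - y‖ ^ ((N : ℝ) + 2 * s) +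
        (ψ x - -ψ y) ^ 2 / ‖x - reflect ν l y‖ ^ ((N : ℝ) + 2 * s) := by
    rintro t ht (h1 | ⟨h1, h2⟩)
    · have : t / ‖x - y‖ ^ ((N : ℝ) + 2 * s) ≤
          (ψ x - ψ y) ^ 2 / ‖x - y‖ ^ ((N : ℝ) + 2 * s) := by gcongr
      linarith
    · have : t / ‖x - y‖ ^ ((N : ℝ) + 2 * s) ≤
          (ψ x - -ψ y) ^ 2 / ‖x - reflect ν l y‖ ^ ((N : ℝ) + 2 * s) := by
        rw [sub_neg_eq_add, div_eq_mul_inv, div_eq_mul_inv]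
        exact mul_le_mul h1 h2 hK (sq_nonneg _)
      linarith
  refine fin _ (sq_nonneg _) ?_
  rcases le_or_gt (inner ℝ x ν) l with hx | hx <;> rcases le_or_gt (inner ℝ y ν) l with hy | hy
  · left
    rw [halfPos_of_le hx, halfPos_of_le hy]
    exact sq_le_sq.2 (abs_max_sub_max_le_abs _ _ _)
  · rw [halfPos_of_le hx, halfPos_of_lt hy, sub_zero]
    refine (sq_max_le_of_sign (ψ x) (ψ y)).imp_right fun ⟨h1, h2⟩ => ⟨h1, ?_⟩
    have hne : x ≠ reflect ν l y := by
      rintro rfl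
      exact h2 (hψ y)
    have := inv_rpow_norm_sub_reflect_le hs hν hne hx (hRle hy)
    rwa [reflect_reflect hν] at this
  · rw [halfPos_of_lt hx, halfPos_of_le hy, zero_sub, neg_sq, sub_sq_comm, add_comm (ψ x)]
    refine (sq_max_le_of_sign (ψ y) (ψ x)).imp_right fun ⟨h1, h2⟩ => ⟨h1, ?_⟩
    have hne : reflect ν l x ≠ y := by
      rintro rfl
      exact h2 (hψ x)
    have := inv_rpow_norm_sub_reflect_le hs hν hne (hRle hx) hy
    rwa [norm_reflect_sub_reflect hν, norm_reflect_sub hν] at this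
  · left
    rw [halfPos_of_lt hx, halfPos_of_lt hy]
    simp [sq_nonneg]

/-- The integrand of the form summed over an orbit of the reflections. -/
lemma sum_reflect_form_halfPos (hν : ‖ν‖ = 1)
    (hψ : ∀ x, ψ (reflect ν l x) = - ψ x) {x y : E N}
    (hx : inner ℝ x ν ≤ l) (hy : inner ℝ y ν ≤ l) (p : ℝ) :
    (ψ x - ψ y) * (halfPos ν l ψ x - halfPos ν l ψ y) / ‖x - y‖ ^ p +
    (ψ x - ψ (reflect ν l y)) * (halfPos ν l ψ x - halfPos ν l ψ (reflect ν l y)) /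
      ‖x - reflect ν l y‖ ^ p +
    (ψ (reflect ν l x) - ψ y) * (halfPos ν l ψ (reflect ν l x) - halfPos ν l ψ y) /
      ‖reflect ν l x - y‖ ^ p +
    (ψ (reflect ν l x) - ψ (reflect ν l y)) *
      (halfPos ν l ψ (reflect ν l x) - halfPos ν l ψ (reflect ν l y)) /
      ‖reflect ν l x - reflect ν l y‖ ^ p =
    (ψ x - ψ y) * (max (ψ x) 0 - max (ψ y) 0) * (‖x - y‖ ^ p)⁻¹ +
      (ψ x + ψ y) * (max (ψ x) 0 + max (ψ y) 0) * (‖x - reflect ν l y‖ ^ p)⁻¹ := by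
  rw [halfPos_reflect hν hψ hx, halfPos_reflect hν hψ hy, halfPos_of_le hx, halfPos_of_le hy,
    hψ, hψ, norm_reflect_sub hν, norm_reflect_sub_reflect hν]
  ring

/-- `K` and `J` stand for the kernels at |x - y| and |x - R y|. The cross term on the left, present
when p > 0 > q, is the source of the nonlocal gain. The alternative `p = q` covers the diagonal,
where `K` is the default value 0. -/
lemma orbit_sum_ge {p q K J : ℝ} (h : J ≤ K ∨ p = q) :
    (max p 0 - max q 0) ^ 2 * K + (max p 0 + max q 0) ^ 2 * J +
      max p 0 * max (-q) 0 * (K - J) ≤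
    (p - q) * (max p 0 - max q 0) * K + (p + q) * (max p 0 + max q 0) * J := by
  rcases h with h | rfl
  · have hKJ := sub_nonneg.2 h
    rcases le_total p 0 with hp | hp <;> rcases le_total q 0 with hq | hq
    · rw [max_eq_right hp, max_eq_right hq]; simp
    · rw [max_eq_right hp, max_eq_left hq, max_eq_right (by linarith : -q ≤ 0)]
      nlinarith [mul_nonneg (mul_nonneg (neg_nonneg.2 hp) hq) hKJ]
    · rw [max_eq_left hp, max_eq_right hq, max_eq_left (by linarith : 0 ≤ -q)]
      exact le_of_eq (by ring)
    · rw [max_eq_left hp, max_eq_left hq, max_eq_right (by linarith : -q ≤ 0)]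
      exact le_of_eq (by ring)
  · rcases le_total p 0 with hp | hp
    · rw [max_eq_right hp]; simp
    · rw [max_eq_left hp, max_eq_right (by linarith : -p ≤ 0)]
      exact le_of_eq (by ring)

lemma orbit_cross_nonneg {p q K J : ℝ} (h : J ≤ K ∨ p = q) :
    0 ≤ max p 0 * max (-q) 0 * (K - J) := by
  rcases h with h | rfl
  · exact mul_nonneg (mul_nonneg (le_max_right _ _) (le_max_right _ _)) (sub_nonneg.2 h)
  · rcases le_total p 0 with hp | hp
    · rw [max_eq_right hp]; simp
    · rw [max_eq_right (by linarith : -p ≤ 0)]; simp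

lemma orbit_kernel_cond (hs : 0 < s) (hν : ‖ν‖ = 1) {x y : E N}
    (hx : inner ℝ x ν ≤ l) (hy : inner ℝ y ν ≤ l) :
    (‖x - reflect ν l y‖ ^ ((N : ℝ) + 2 * s))⁻¹ ≤ (‖x - y‖ ^ ((N : ℝ) + 2 * s))⁻¹ ∨
      ψ x = ψ y := by
  by_cases hxy : x = y
  · exact Or.inr (by rw [hxy])
  · exact Or.inl (inv_rpow_norm_sub_reflect_le hs hν hxy hx hy)

/-- For an antisymmetric function the energy of its positive part in the half space is
controlled by the form. -/
lemma gagliardoForm_halfPos_self_le (hs : 0 < s) (hν : ‖ν‖ = 1) (h : MemHs s ψ)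
    (hψ : ∀ x, ψ (reflect ν l x) = - ψ x) :
    ∫ z : E N × E N, (halfPos ν l ψ z.1 - halfPos ν l ψ z.2) ^ 2 /
      ‖z.1 - z.2‖ ^ ((N : ℝ) + 2 * s) ≤ gagliardoForm s ψ (halfPos ν l ψ) := by
  have hφ := h.halfPos hs hν hψ
  refine integral_le_integral_of_sum_reflect_le hν l (h.integrable_form hφ) hφ.gagliardo
    fun x y hx hy => ?_
  simp only
  rw [sum_reflect_form_halfPos hν hψ hx hy, halfPos_reflect hν hψ hx, halfPos_reflect hν hψ hy,
    halfPos_of_le hx, halfPos_of_le hy, norm_reflect_sub hν, norm_reflect_sub_reflect hν]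
  have hJ : 0 ≤ (‖x - reflect ν l y‖ ^ ((N : ℝ) + 2 * s))⁻¹ := by positivity
  have hc := orbit_kernel_cond (ψ := ψ) hs hν hx hy
  refine le_trans ?_ (orbit_sum_ge hc)
  have hp := le_max_right (ψ x) 0
  have hq := le_max_right (ψ y) 0
  have hlast := orbit_cross_nonneg hc
  simp only [div_eq_mul_inv]
  -- The squares produce p₊²J + q₊²J where (p₊ + q₊)²J is available; the surplus 2p₊q₊J is
  -- nonnegative.
  nlinarith [mul_nonneg (mul_nonneg hp hq) hJ]

/-- The nonlocal gain in the form coming from a set `U` where `ψ` is negative. -/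
lemma mul_setIntegral_le_gagliardoForm_halfPos (hs : 0 < s) (hν : ‖ν‖ = 1) (h : MemHs s ψ)
    (hψ : ∀ x, ψ (reflect ν l x) = - ψ x) {B U : Set (E N)} {k : ℝ}
    (hφi : IntegrableOn (halfPos ν l ψ) B)
    (hB : MeasurableSet B) (hU : MeasurableSet U) (hUfin : volume U ≠ ⊤)
    (hUl : ∀ y ∈ U, inner ℝ y ν < l)
    (hk : ∀ x ∈ B, ∀ y ∈ U, k ≤ (-ψ y) * ((‖x - y‖ ^ ((N : ℝ) + 2 * s))⁻¹ -
      (‖x - reflect ν l y‖ ^ ((N : ℝ) + 2 * s))⁻¹))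
    (hneg : ∀ y ∈ U, ψ y ≤ 0) :
    k * volume.real U * (∫ x in B, halfPos ν l ψ x) ≤ gagliardoForm s ψ (halfPos ν l ψ) := by
  have hφ := h.halfPos hs hν hψ
  have hG : Integrable (fun z : E N × E N =>
      B.indicator (halfPos ν l ψ) z.1 * U.indicator (fun _ => k) z.2) volume :=
    ((integrable_indicator_iff hB).2 hφi).mul_prod
      ((integrable_indicator_iff hU).2 (integrableOn_const hUfin))
  have hGe : ∫ z : E N × E N, B.indicator (halfPos ν l ψ) z.1 * U.indicator (fun _ => k) z.2 =
      k * volume.real U * (∫ x in B, halfPos ν l ψ x) := by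
    rw [Measure.volume_eq_prod, integral_prod_mul, integral_indicator hB, integral_indicator hU,
      setIntegral_const, smul_eq_mul]
    ring
  rw [← hGe]
  refine integral_le_integral_of_sum_reflect_le hν l (h.integrable_form hφ) hG
    fun x y hx hy => ?_
  simp only
  rw [sum_reflect_form_halfPos hν hψ hx hy]
  have hJ : 0 ≤ (‖x - reflect ν l y‖ ^ ((N : ℝ) + 2 * s))⁻¹ := by positivity
  have hK : 0 ≤ (‖x - y‖ ^ ((N : ℝ) + 2 * s))⁻¹ := by positivity
  have hc := orbit_kernel_cond (ψ := ψ) hs hν hx hy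
  refine le_trans ?_ (orbit_sum_ge hc)
  have hp := le_max_right (ψ x) 0
  have hq := le_max_right (ψ y) 0
  -- Of the four orbit terms of the product only the one at (x, y) survives, and the cross term of
  -- `orbit_sum_ge` alone dominates it.
  have h1 : B.indicator (halfPos ν l ψ) (reflect ν l x) = 0 := by
    by_cases hb : reflect ν l x ∈ B
    · rw [indicator_of_mem hb, halfPos_reflect hν hψ hx]
    · exact indicator_of_notMem hb _
  have h2 : U.indicator (fun _ => k) (reflect ν l y) = 0 := by
    refine indicator_of_notMem (fun hu => ?_) _
    have := hUl _ hu
    rw [inner_reflect hν] at this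
    linarith
  rw [h1, h2]
  have hsq : 0 ≤ (max (ψ x) 0 - max (ψ y) 0) ^ 2 * (‖x - y‖ ^ ((N : ℝ) + 2 * s))⁻¹ +
      (max (ψ x) 0 + max (ψ y) 0) ^ 2 * (‖x - reflect ν l y‖ ^ ((N : ℝ) + 2 * s))⁻¹ := by
    positivity
  have hlast := orbit_cross_nonneg hc
  by_cases hxB : x ∈ B
  · by_cases hyU : y ∈ U
    · rw [indicator_of_mem hxB, indicator_of_mem hyU, halfPos_of_le hx]
      have := mul_le_mul_of_nonneg_left (hk x hxB y hyU) hp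
      rw [max_eq_left (by linarith [hneg y hyU] : 0 ≤ -ψ y)]
      linarith
    · rw [indicator_of_notMem hyU]
      linarith
  · rw [indicator_of_notMem hxB]
    linarith

end PosPart

/-! ### Poincaré inequality on sets of small measure. -/

section Poincare

lemma volume_real_ball [Nontrivial (E N)] (x : E N) {r : ℝ} (hr : 0 ≤ r) :
    volume.real (Metric.ball x r) = r ^ N * volume.real (Metric.ball (0 : E N) 1) := by
  rw [Measure.real, Measure.addHaar_ball _ _ hr, ENNReal.toReal_mul,
    ENNReal.toReal_ofReal (by positivity), finrank_euclideanSpace_fin]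
  rfl

/-- The fractional Poincaré inequality for functions supported in a set of small measure. -/
lemma exists_poincare_of_small_measure [Nontrivial (E N)] (hs : 0 < s) (C : ℝ) :
    ∃ τ : ℝ, 0 < τ ∧ ∀ A : Set (E N), MeasurableSet A → volume A ≤ ENNReal.ofReal τ →
      ∀ φ : E N → ℝ, MemHs s φ → (∀ᵐ x, x ∉ A → φ x = 0) →
      C * ∫ x, φ x ^ 2 ≤ ∫ z : E N × E N,
        (φ z.1 - φ z.2) ^ 2 / ‖z.1 - z.2‖ ^ ((N : ℝ) + 2 * s) := by
  set V := volume.real (Metric.ball (0 : E N) 1) with hV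
  have hvpos : 0 < V :=
    ENNReal.toReal_pos (Metric.measure_ball_pos _ _ one_pos).ne' measure_ball_lt_top.ne
  -- Half the volume of a ball of radius ρ, weighted by ρ^(-N-2s), is V/2 · ρ^(-2s), which is large
  -- for small ρ. Replacing C by `max C 1` allows C of any sign.
  obtain ⟨ρ, hρ, hρC⟩ : ∃ ρ : ℝ, 0 < ρ ∧ C ≤ V / 2 * (ρ ^ (2 * s))⁻¹ := by
    set D := max C 1
    have hD : 0 < D := lt_of_lt_of_le one_pos (le_max_right _ _)
    refine ⟨(V / 2 / D) ^ (1 / (2 * s)), by positivity, ?_⟩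
    rw [← Real.rpow_mul (by positivity), one_div_mul_cancel (by positivity), Real.rpow_one,
      inv_div, mul_div_cancel₀ _ (by positivity)]
    exact le_max_left _ _
  refine ⟨ρ ^ N * V / 2, by positivity, fun A hA hAτ φ hφ hφA => ?_⟩
  set p : ℝ := (N : ℝ) + 2 * s with hp
  have hppos : 0 < p := by positivity
  -- On this set φ z.2 = 0 almost everywhere, and off the diagonal the kernel is at least ρ^(-p).
  set S : Set (E N × E N) := {z | ‖z.1 - z.2‖ < ρ ∧ z.2 ∉ A} with hS
  have hSm : MeasurableSet S := by
    have h1 : MeasurableSet {z : E N × E N | ‖z.1 - z.2‖ < ρ} :=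
      (isOpen_lt (by fun_prop) continuous_const).measurableSet
    exact h1.inter (measurable_snd hA.compl)
  set G : E N × E N → ℝ := S.indicator (fun z => φ z.1 ^ 2 * (ρ ^ p)⁻¹) with hG
  have hGle : ∀ᵐ z : E N × E N, G z ≤ (φ z.1 - φ z.2) ^ 2 / ‖z.1 - z.2‖ ^ p := by
    have h2 : ∀ᵐ z : E N × E N, z.2 ∉ A → φ z.2 = 0 :=
      (Measure.quasiMeasurePreserving_snd (μ := volume) (ν := volume)).ae hφA
    filter_upwards [h2] with z hz
    by_cases hzS : z ∈ S
    · rw [hG, indicator_of_mem hzS, hz hzS.2, sub_zero, div_eq_mul_inv]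
      by_cases hzz : z.1 = z.2
      · rw [hzz, hz hzS.2]; simp
      · have h0 : 0 < ‖z.1 - z.2‖ := norm_pos_iff.2 (sub_ne_zero.2 hzz)
        have := hzS.1
        gcongr
    · rw [hG, indicator_of_notMem hzS]; positivity
  have hGnn : ∀ z, 0 ≤ G z := fun z => indicator_nonneg (fun z _ => by positivity) z
  have hGi : Integrable G volume := by
    refine hφ.gagliardo.mono' ?_ ?_
    · refine AEStronglyMeasurable.indicator ?_ hSm
      exact (hφ.aestronglyMeasurable.comp_fst.pow 2).mul aestronglyMeasurable_const
    · filter_upwards [hGle] with z hz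
      rwa [Real.norm_of_nonneg (hGnn z)]
  refine le_trans ?_ (integral_mono_ae hGi hφ.gagliardo hGle)
  have hsec : ∀ x, ∫ y, G (x, y) = φ x ^ 2 * (ρ ^ p)⁻¹ * volume.real (Metric.ball x ρ \ A) := by
    intro x
    have : ∀ y, G (x, y) = (Metric.ball x ρ \ A).indicator (fun _ => φ x ^ 2 * (ρ ^ p)⁻¹) y := by
      intro y
      have hiff : (x, y) ∈ S ↔ y ∈ Metric.ball x ρ \ A := by
        rw [Set.mem_sdiff, mem_ball_iff_norm']; exact Iff.rfl
      by_cases h : (x, y) ∈ S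
      · rw [hG, indicator_of_mem h, indicator_of_mem (hiff.1 h)]
      · rw [hG, indicator_of_notMem h, indicator_of_notMem (mt hiff.2 h)]
    simp_rw [this]
    rw [integral_indicator (Metric.isOpen_ball.measurableSet.diff hA), setIntegral_const,
      smul_eq_mul, mul_comm]
  -- A has at most half the volume of a ball of radius ρ, so it misses at least half of each such
  -- ball.
  have hvol : ∀ x : E N, ρ ^ N * V / 2 ≤ volume.real (Metric.ball x ρ \ A) := by
    intro x
    have h1 : volume.real A ≤ ρ ^ N * V / 2 :=
      ENNReal.toReal_le_of_le_ofReal (by positivity) hAτ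
    have h2 := le_measureReal_sdiff (μ := volume) (s₁ := Metric.ball x ρ) (s₂ := A)
      (ne_top_of_le_ne_top ENNReal.ofReal_ne_top hAτ)
    rw [volume_real_ball x hρ.le] at h2
    linarith
  rw [Measure.volume_eq_prod, integral_prod _ hGi, ← integral_const_mul]
  refine integral_mono (hφ.memLp.integrable_sq.const_mul C) hGi.integral_prod_left fun x => ?_
  simp only [hsec]
  have hfin : C ≤ (ρ ^ p)⁻¹ * (ρ ^ N * V / 2) := by
    refine hρC.trans (le_of_eq ?_)
    rw [hp, Real.rpow_add hρ, Real.rpow_natCast]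
    field_simp
  calc C * φ x ^ 2 ≤ (ρ ^ p)⁻¹ * (ρ ^ N * V / 2) * φ x ^ 2 := by gcongr
    _ = φ x ^ 2 * (ρ ^ p)⁻¹ * (ρ ^ N * V / 2) := by ring
    _ ≤ _ := by gcongr; exact hvol x

end Poincare

/-! ### The barrier: a truncated paraboloid. -/

section Barrier

/-- In polar coordinates the integrand is t^(1-2s) on (0, 1) and t^(-1-2s) beyond, integrable
because s < 1 and s > 0 respectively. -/
lemma integrable_min_sq_div_rpow [Nontrivial (E N)] (hs0 : 0 < s) (hs1 : s < 1) :
    Integrable (fun h : E N => min (‖h‖ ^ 2) 1 / ‖h‖ ^ ((N : ℝ) + 2 * s)) volume := by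
  rw [integrable_fun_norm_addHaar volume
    (f := fun t : ℝ => min (t ^ 2) 1 / t ^ ((N : ℝ) + 2 * s)), finrank_euclideanSpace_fin]
  have hN : 1 ≤ N := by
    by_contra h
    obtain rfl : N = 0 := by omega
    exact not_subsingleton (E 0) inferInstance
  have hpow : ∀ t : ℝ, 0 < t → ∀ a : ℝ,
      t ^ (N - 1) * (t ^ a / t ^ ((N : ℝ) + 2 * s)) = t ^ (a - 1 - 2 * s) := by
    intro t ht a
    rw [← Real.rpow_natCast, ← Real.rpow_sub ht, ← Real.rpow_add ht]
    congr 1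
    push_cast [hN]
    ring
  rw [← Ioc_union_Ioi_eq_Ioi (zero_le_one' ℝ), integrableOn_union]
  constructor
  · rw [integrableOn_Ioc_iff_integrableOn_Ioo]
    refine ((intervalIntegral.integrableOn_Ioo_rpow_iff one_pos).2
      (by linarith : -1 < (2 : ℝ) - 1 - 2 * s)).congr_fun (fun t ht => ?_) measurableSet_Ioo
    have : t ^ 2 ≤ 1 := pow_le_one₀ ht.1.le ht.2.le
    simp only [smul_eq_mul]
    rw [min_eq_left this, ← hpow t ht.1 2, Real.rpow_two]
  · refine (integrableOn_Ioi_rpow_of_lt (by linarith : (0 : ℝ) - 1 - 2 * s < -1) one_pos).congr_fun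
      (fun t ht => ?_) measurableSet_Ioi
    have ht1 : 1 < t := ht
    have : 1 ≤ t ^ 2 := one_le_pow₀ ht1.le
    simp only [smul_eq_mul]
    rw [min_eq_right this, ← hpow t (one_pos.trans ht1) 0, Real.rpow_zero]

/-- A one-sided bound on second differences of `ζ` bounds the form from above on nonnegative
functions. -/
lemma gagliardoForm_le_of_second_difference_le [Nontrivial (E N)] (hs0 : 0 < s) (hs1 : s < 1)
    {ζ φ : E N → ℝ} {B : Set (E N)} {C M : ℝ} (hζ : MemHs s ζ) (hφ : MemHs s φ)
    (hM : ∀ x, |ζ x| ≤ M) (hφ0 : ∀ x, 0 ≤ φ x) (hφi : Integrable φ)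
    (hφB : ∀ᵐ x, x ∉ B → φ x = 0)
    (hC : ∀ x ∈ B, ∀ h, 2 * ζ x - ζ (h + x) - ζ (-h + x) ≤ C * min (‖h‖ ^ 2) 1) :
    gagliardoForm s ζ φ ≤
      C * (∫ h : E N, min (‖h‖ ^ 2) 1 / ‖h‖ ^ ((N : ℝ) + 2 * s)) * ∫ x, φ x := by
  set p : ℝ := (N : ℝ) + 2 * s
  have hT := measurePreserving_add_prod (volume : Measure (E N)) (volume : Measure (E N))
  have hFi := hζ.integrable_form hφ
  have hTi := hT.integrable_comp_of_integrable hFi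
  have hTe : MeasurableEmbedding (fun z : E N × E N => (z.1 + z.2, z.2)) :=
    (MeasurableEquiv.mk ⟨fun z : E N × E N => (z.1 + z.2, z.2), fun z => (z.1 - z.2, z.2),
      fun z => by simp, fun z => by simp⟩ (by simp only [Equiv.coe_fn_mk]; fun_prop)
      (by simp only [Equiv.coe_fn_symm_mk]; fun_prop)).measurableEmbedding
  have hint := hT.integral_comp hTe (fun z : E N × E N =>
    (ζ z.1 - ζ z.2) * (φ z.1 - φ z.2) / ‖z.1 - z.2‖ ^ p)
  simp only [Function.comp_def, add_sub_cancel_right] at hTi hint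
  rw [gagliardoForm, Measure.volume_eq_prod, ← hint, integral_prod _ hTi]
  have hinner : ∀ h : E N, ∫ y, (ζ (h + y) - ζ y) * (φ (h + y) - φ y) ≤
      C * min (‖h‖ ^ 2) 1 * ∫ x, φ x := by
    intro h
    have hζm := hζ.aestronglyMeasurable
    have hb : ∀ (w : E N), Integrable (fun y => ζ (w + y) * φ y) := fun w =>
      hφi.bdd_mul (c := M)
        (hζm.comp_measurePreserving (measurePreserving_add_left volume w))
        (Filter.Eventually.of_forall fun y => hM _)
    have i₀ : Integrable (fun y => ζ y * φ y) := by simpa using hb 0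
    have i₁ : Integrable (fun y => ζ (h + y) * φ (h + y)) := i₀.comp_add_left h
    have i₃ : Integrable (fun y => ζ y * φ (h + y)) := by
      simpa using (hb (-h)).comp_add_left h
    have e₁ : ∫ y, ζ (h + y) * φ (h + y) = ∫ y, ζ y * φ y :=
      integral_add_left_eq_self (fun y => ζ y * φ y) h
    have e₃ : ∫ y, ζ y * φ (h + y) = ∫ y, ζ (-h + y) * φ y := by
      simpa using integral_add_left_eq_self (fun y => ζ (-h + y) * φ y) h
    -- Summation by parts at fixed h: translation invariance moves both differences onto ζ, so no
    -- principal value is needed.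
    have hsum : ∫ y, (ζ (h + y) - ζ y) * (φ (h + y) - φ y) =
        ∫ y, (2 * ζ y - ζ (h + y) - ζ (-h + y)) * φ y := by
      have l1 : ∫ y, (ζ (h + y) - ζ y) * (φ (h + y) - φ y) =
          ∫ y, (ζ (h + y) * φ (h + y) - ζ (h + y) * φ y - ζ y * φ (h + y) + ζ y * φ y) := by
        congr 1; ext y; ring
      have l2 : ∫ y, (2 * ζ y - ζ (h + y) - ζ (-h + y)) * φ y =
          ∫ y, (ζ y * φ y - ζ (h + y) * φ y - ζ (-h + y) * φ y + ζ y * φ y) := by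
        congr 1; ext y; ring
      have split : ∀ {a b c d : E N → ℝ}, Integrable a → Integrable b → Integrable c →
          Integrable d → ∫ y, (a y - b y - c y + d y) =
            (∫ y, a y) - (∫ y, b y) - (∫ y, c y) + ∫ y, d y := by
        intro a b c d ha hb hc hd
        have h₁ := integral_add ((ha.sub hb).sub hc) hd
        have h₂ := integral_sub (ha.sub hb) hc
        have h₃ := integral_sub ha hb
        simp only [Pi.sub_apply] at h₁ h₂ h₃
        rw [h₁, h₂, h₃]
      rw [l1, l2, split i₁ (hb h) i₃ i₀, split i₀ (hb h) (hb (-h)) i₀, e₁, e₃]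
    rw [hsum, ← integral_const_mul]
    refine integral_mono_ae ?_ (hφi.const_mul _) ?_
    · have : (fun y => (2 * ζ y - ζ (h + y) - ζ (-h + y)) * φ y) =
          fun y => 2 * (ζ y * φ y) - ζ (h + y) * φ y - ζ (-h + y) * φ y := by
        ext y; ring
      rw [this]
      exact ((i₀.const_mul 2).sub (hb h)).sub (hb (-h))
    · filter_upwards [hφB] with y hy
      by_cases hyB : y ∈ B
      · exact mul_le_mul_of_nonneg_right (hC y hyB h) (hφ0 y)
      · simp [hy hyB]
  have hκ := (integrable_min_sq_div_rpow (N := N) hs0 hs1)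
  have hre : C * (∫ h : E N, min (‖h‖ ^ 2) 1 / ‖h‖ ^ p) * ∫ x, φ x =
      ∫ h : E N, (C * ∫ x, φ x) * (min (‖h‖ ^ 2) 1 / ‖h‖ ^ p) := by
    rw [integral_const_mul]; ring
  rw [hre]
  refine integral_mono hTi.integral_prod_left (hκ.const_mul _) fun h => ?_
  simp only
  rw [integral_div]
  calc (∫ y, (ζ (h + y) - ζ y) * (φ (h + y) - φ y)) / ‖h‖ ^ p
      ≤ C * min (‖h‖ ^ 2) 1 * (∫ x, φ x) / ‖h‖ ^ p := by gcongr; exact hinner h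
    _ = _ := by ring

/-- The truncated paraboloid `(r² - |x - c|²)⁺`. -/
def bump (c : E N) (r : ℝ) (x : E N) : ℝ := max (r ^ 2 - ‖x - c‖ ^ 2) 0

variable {c : E N} {r : ℝ}

lemma bump_nonneg (x : E N) : 0 ≤ bump c r x := le_max_right _ _

lemma bump_le_one (hr0 : 0 ≤ r) (hr1 : r ≤ 1) (x : E N) : bump c r x ≤ 1 :=
  max_le (by nlinarith [sq_nonneg ‖x - c‖]) zero_le_one

lemma bump_of_notMem (hr0 : 0 ≤ r) {x : E N} (hx : x ∉ Metric.ball c r) : bump c r x = 0 := by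
  rw [Metric.mem_ball, not_lt, dist_eq_norm] at hx
  exact max_eq_right (by nlinarith)

lemma continuous_bump : Continuous (bump c r) := by
  unfold bump; fun_prop

/-- By the parallelogram law the untruncated paraboloid gives exactly 2|h|²; truncation at zero adds
only convex kinks, which have the favourable sign. -/
lemma bump_second_difference_le (x h : E N) :
    2 * bump c r x - bump c r (h + x) - bump c r (-h + x) ≤ 2 * ‖h‖ ^ 2 := by
  have h1 : r ^ 2 - ‖h + x - c‖ ^ 2 ≤ bump c r (h + x) := le_max_left _ _
  have h2 : r ^ 2 - ‖-h + x - c‖ ^ 2 ≤ bump c r (-h + x) := le_max_left _ _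
  have h3 := bump_nonneg (c := c) (r := r) (h + x)
  have h4 := bump_nonneg (c := c) (r := r) (-h + x)
  have h5 := parallelogram_law_with_norm ℝ (x - c) h
  have e1 : h + x - c = (x - c) + h := by abel
  have e2 : -h + x - c = (x - c) - h := by abel
  rw [e1] at h1
  rw [e2] at h2
  rcases le_total (r ^ 2 - ‖x - c‖ ^ 2) 0 with h0 | h0
  · have : bump c r x = 0 := max_eq_right h0
    nlinarith [sq_nonneg ‖h‖]
  · have : bump c r x = r ^ 2 - ‖x - c‖ ^ 2 := max_eq_left h0
    nlinarith

lemma abs_bump_sub_le (hr0 : 0 ≤ r) (hr1 : r ≤ 1) (x y : E N) :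
    |bump c r x - bump c r y| ≤ 2 * ‖x - y‖ := by
  have key : ∀ x : E N, bump c r x = r ^ 2 - (min ‖x - c‖ r) ^ 2 := by
    intro x
    rcases le_total ‖x - c‖ r with h | h
    · rw [min_eq_left h, bump, max_eq_left]
      nlinarith [norm_nonneg (x - c)]
    · rw [min_eq_right h, bump, max_eq_right] <;> nlinarith [norm_nonneg (x - c)]
  have hm : |min ‖y - c‖ r - min ‖x - c‖ r| ≤ ‖x - y‖ := by
    refine (abs_min_sub_min_le_max _ _ _ _).trans ?_
    rw [sub_self, abs_zero, max_eq_left (abs_nonneg _)]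
    refine (abs_norm_sub_norm_le _ _).trans (le_of_eq ?_)
    rw [sub_sub_sub_cancel_right, norm_sub_rev]
  have hs' : |min ‖y - c‖ r + min ‖x - c‖ r| ≤ 2 := by
    rw [abs_of_nonneg (add_nonneg (le_min (norm_nonneg _) hr0) (le_min (norm_nonneg _) hr0))]
    linarith [min_le_right ‖y - c‖ r, min_le_right ‖x - c‖ r]
  have : bump c r x - bump c r y =
      (min ‖y - c‖ r + min ‖x - c‖ r) * (min ‖y - c‖ r - min ‖x - c‖ r) := by
    rw [key x, key y]; ring
  rw [this, abs_mul]
  exact mul_le_mul hs' hm (abs_nonneg _) zero_le_two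

lemma memHs_bump [Nontrivial (E N)] (hs0 : 0 < s) (hs1 : s < 1) (hr0 : 0 ≤ r) (hr1 : r ≤ 1) :
    MemHs s (bump c r) := by
  have hsupp : HasCompactSupport (bump c r) := by
    refine HasCompactSupport.of_support_subset_isCompact (isCompact_closedBall c r) fun x hx => ?_
    by_contra hx'
    exact hx (bump_of_notMem hr0 fun h => hx' (Metric.ball_subset_closedBall h))
  have hκ := integrable_min_sq_div_rpow (N := N) hs0 hs1
  set B := Metric.ball c r
  have hBi : Integrable (B.indicator (fun _ => (4 : ℝ))) volume :=
    (integrable_indicator_iff Metric.isOpen_ball.measurableSet).2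
      (integrableOn_const measure_ball_lt_top.ne)
  -- A pair contributes only if one of its points lies in B, so this function plus its swap is a
  -- dominating function.
  have hD := (measurePreserving_sub_prod (volume : Measure (E N))
    (volume : Measure (E N))).integrable_comp_of_integrable (hκ.mul_prod hBi)
  refine MemHs.of_le (continuous_bump.memLp_of_hasCompactSupport hsupp) (hD.add hD.swap)
    fun z => ?_
  obtain ⟨x, y⟩ := z
  simp only [Pi.add_apply, Function.comp, Prod.swap]
  rw [norm_sub_rev y x]
  have hq : (bump c r x - bump c r y) ^ 2 ≤ 4 * min (‖x - y‖ ^ 2) 1 := by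
    have h1 := abs_bump_sub_le (c := c) hr0 hr1 x y
    have h2 : |bump c r x - bump c r y| ≤ 1 := by
      rw [abs_le]
      constructor <;> linarith [bump_nonneg (c := c) (r := r) x, bump_nonneg (c := c) (r := r) y,
        bump_le_one (c := c) hr0 hr1 x, bump_le_one (c := c) hr0 hr1 y]
    rw [← sq_abs, mul_min_of_nonneg _ _ (by norm_num : (0 : ℝ) ≤ 4)]
    refine le_min ?_ ?_ <;> nlinarith [abs_nonneg (bump c r x - bump c r y)]
  have hpos : 0 ≤ min (‖x - y‖ ^ 2) 1 / ‖x - y‖ ^ ((N : ℝ) + 2 * s) := by positivity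
  have hq' : (bump c r x - bump c r y) ^ 2 / ‖x - y‖ ^ ((N : ℝ) + 2 * s) ≤
      min (‖x - y‖ ^ 2) 1 / ‖x - y‖ ^ ((N : ℝ) + 2 * s) * 4 := by
    rw [div_mul_eq_mul_div, mul_comm _ (4 : ℝ)]
    gcongr
  by_cases hx : x ∈ B <;> by_cases hy : y ∈ B
  · rw [indicator_of_mem hx, indicator_of_mem hy]; linarith
  · rw [indicator_of_mem hx, indicator_of_notMem hy]; linarith
  · rw [indicator_of_notMem hx, indicator_of_mem hy]; linarith
  · rw [bump_of_notMem hr0 hx, bump_of_notMem hr0 hy, indicator_of_notMem hx,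
      indicator_of_notMem hy]
    simp

end Barrier

/-- Γ(1-s) = -sΓ(-s) is positive, so Γ(-s) < 0. -/
lemma fracConst_pos (hs0 : 0 < s) (hs1 : s < 1) : 0 < fracConst N s := by
  have h1 : 0 < Real.Gamma (1 - s) := Real.Gamma_pos_of_pos (by linarith)
  have h2 : Real.Gamma (-s + 1) = -s * Real.Gamma (-s) := Real.Gamma_add_one (by linarith)
  rw [neg_add_eq_sub] at h2
  have h3 : Real.Gamma (-s) < 0 := by nlinarith
  have h4 : 0 < Real.Gamma ((N : ℝ) / 2 + s) := Real.Gamma_pos_of_pos (by positivity)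
  have h5 : 0 < Real.pi ^ ((N : ℝ) / 2) := by positivity
  have h6 : 0 < -(Real.pi ^ ((N : ℝ) / 2) * Real.Gamma (-s)) := by nlinarith
  unfold fracConst
  positivity

/-- Sets of full measure are dense. This turns φ = 0 almost everywhere into a pointwise conclusion
at points of continuity. -/
lemma exists_of_ae_of_eventually {p q : E N → Prop} {x : E N} (hp : ∀ᵐ y, p y)
    (hq : ∀ᶠ y in nhds x, q y) : ∃ y, p y ∧ q y := by
  obtain ⟨y, hy1, hy2⟩ := mem_closure_iff_nhds.1 (Measure.dense_of_ae hp x) _ hq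
  exact ⟨y, hy2, hy1⟩

lemma volume_hyperplane {ν : E N} (hν : ‖ν‖ = 1) (l : ℝ) :
    volume {x : E N | inner ℝ x ν = l} = 0 := by
  have hle : {x : E N | inner ℝ x ν = l} ⊆
      (AffineSubspace.mk' (l • ν) (Submodule.span ℝ {ν})ᗮ : Set (E N)) := by
    intro x hx
    have hx' : inner ℝ x ν = l := hx
    rw [SetLike.mem_coe, AffineSubspace.mem_mk', Submodule.mem_orthogonal_singleton_iff_inner_left,
      vsub_eq_sub, inner_sub_left, inner_smul_left, real_inner_self_eq_norm_sq, hν, hx']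
    simp
  refine measure_mono_null hle (Measure.addHaar_affineSubspace _ _ fun htop => ?_)
  have : (l + 1) • ν ∈ AffineSubspace.mk' (l • ν) (Submodule.span ℝ {ν})ᗮ := by
    rw [htop]; trivial
  rw [AffineSubspace.mem_mk', Submodule.mem_orthogonal_singleton_iff_inner_left,
    vsub_eq_sub, ← sub_smul, inner_smul_left, real_inner_self_eq_norm_sq, hν] at this
  norm_num at this

/-! ### Caps and their reflections. -/

section Caps

variable {Ω : Set (E N)} {ν : E N} {l : ℝ}

lemma aInf_le (hΩ : Bornology.IsBounded Ω) (hν : ‖ν‖ = 1) {x : E N} (hx : x ∈ Ω) :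
    aInf Ω ν ≤ inner ℝ x ν := by
  obtain ⟨R, hR⟩ := hΩ.exists_norm_le
  refine csInf_le ⟨-R, ?_⟩ (mem_image_of_mem _ hx)
  rintro _ ⟨y, hy, rfl⟩
  have h1 := abs_real_inner_le_norm y ν
  rw [hν, mul_one] at h1
  have h2 := neg_abs_le (inner ℝ y ν)
  have h3 := hR y hy
  show -R ≤ inner ℝ y ν
  linarith

lemma reflect_mem_of_mem_cap (hΩ : Bornology.IsBounded Ω) (hν : ‖ν‖ = 1)
    (hl : l < lambda1 Ω ν) {x : E N} (hx : x ∈ cap Ω ν l) : reflect ν l x ∈ Ω := by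
  have hne : {l : ℝ | ∀ m ≤ l, reflect ν m '' cap Ω ν m ⊆ Ω}.Nonempty := by
    refine ⟨aInf Ω ν, fun m hm => ?_⟩
    rintro _ ⟨y, hy, rfl⟩
    exact absurd (aInf_le hΩ hν hy.1) (not_le.2 (lt_of_lt_of_le hy.2 hm))
  obtain ⟨m, hm, hlm⟩ := exists_lt_of_lt_csSup hne hl
  exact hm l hlm.le (mem_image_of_mem _ hx)

lemma isOpen_cap (hΩ : IsOpen Ω) : IsOpen (cap Ω ν l) := by
  have h : IsOpen {x : E N | inner ℝ x ν < l} := isOpen_lt (by fun_prop) continuous_const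
  exact hΩ.inter h

/-- Beyond the optimal position the domain is not symmetric: some points below the domain are
reflected into it. -/
lemma exists_below_reflect_mem (hΩ : Bornology.IsBounded Ω) (hne : Ω.Nonempty) (hν : ‖ν‖ = 1)
    (hl : l < lambda1 Ω ν) (hal : aInf Ω ν ≤ l) :
    ∃ y, inner ℝ y ν < aInf Ω ν ∧ reflect ν l y ∈ Ω ∧ reflect ν l y ≠ 0 := by
  obtain ⟨m, hlm, hm⟩ := exists_between hl
  obtain ⟨m', hlm', hm'⟩ := exists_between hlm
  obtain ⟨_, ⟨z, hz, rfl⟩, hza⟩ := exists_lt_of_csInf_lt (hne.image (fun x => inner ℝ x ν))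
    (show aInf Ω ν < aInf Ω ν + (m' - l) by linarith)
  have hza' : inner ℝ z ν < aInf Ω ν + (m' - l) := hza
  -- R_l∘R_t is the translation by -2(t-l)ν, which pushes z, chosen near the bottom of Ω, below Ω.
  -- Two candidate levels are kept because at most one of them sends z to the pole.
  have key : ∀ t, l < t → m' ≤ t → t < lambda1 Ω ν → reflect ν t z ≠ 0 →
      ∃ y, inner ℝ y ν < aInf Ω ν ∧ reflect ν l y ∈ Ω ∧ reflect ν l y ≠ 0 := by
    intro t hlt hmt ht h0
    refine ⟨reflect ν l (reflect ν t z), ?_, ?_, ?_⟩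
    · rw [inner_reflect hν, inner_reflect hν]; linarith
    · rw [reflect_reflect hν]
      exact reflect_mem_of_mem_cap hΩ hν ht ⟨hz, by linarith⟩
    · rwa [reflect_reflect hν]
  by_cases h0 : reflect ν m z = 0
  · refine key m' hlm' le_rfl (hm'.trans hm) fun h0' => ?_
    have h1 := inner_reflect hν m z
    have h2 := inner_reflect hν m' z
    rw [h0, inner_zero_left] at h1
    rw [h0', inner_zero_left] at h2
    linarith
  · exact key m hlm hm'.le hm h0

end Caps

/-! ### The weak equation and its reflected version. -/

section WeakForm

variable {Ω : Set (E N)} {f : E N → ℝ → ℝ} {g : ℝ → ℝ} {u φ : E N → ℝ} {ν : E N} {l M : ℝ}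

/-- The right-hand side `g(u)/|x|^(2s) + f(x,u)`, extended by zero outside `Ω`. -/
def source (s : ℝ) (Ω : Set (E N)) (f : E N → ℝ → ℝ) (g : ℝ → ℝ) (u : E N → ℝ) : E N → ℝ :=
  Ω.indicator fun x => g (u x) / ‖x‖ ^ (2 * s) + f x (u x)

lemma source_of_mem {x : E N} (hx : x ∈ Ω) :
    source s Ω f g u x = g (u x) / ‖x‖ ^ (2 * s) + f x (u x) :=
  indicator_of_mem hx _

namespace IsWeakSolution

lemma integrable_source (hu : IsWeakSolution s Ω f g u) (hΩ : IsOpen Ω) :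
    Integrable (source s Ω f g u) :=
  (integrable_indicator_iff hΩ.measurableSet).2 (hu.integrable_g.add hu.integrable_f)

lemma form_eq (hu : IsWeakSolution s Ω f g u) (hΩ : IsOpen Ω) (hφ : MemHs0 s Ω φ)
    (hM : ∀ᵐ x, |φ x| ≤ M) :
    (1 / 2) * fracConst N s * gagliardoForm s u φ = ∫ x, source s Ω f g u x * φ x := by
  have hφm := hφ.memHs.aestronglyMeasurable
  have hMr : ∀ᵐ x ∂(volume.restrict Ω), ‖φ x‖ ≤ M := ae_restrict_of_ae hM
  have h := hu.weak_eq φ hφ (memLp_top_of_bound hφm.restrict M hMr)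
  rw [setIntegral_eq_integral_of_forall_compl_eq_zero] at h
  · rw [gagliardoForm, h, ← integral_add (hu.integrable_g.mul_bdd (c := M) hφm.restrict hMr)
      (hu.integrable_f.mul_bdd (c := M) hφm.restrict hMr), ← integral_indicator hΩ.measurableSet]
    congr 1
    ext x
    by_cases hx : x ∈ Ω
    · rw [indicator_of_mem hx, source_of_mem hx, add_mul]
    · rw [indicator_of_notMem hx, source, indicator_of_notMem hx, zero_mul]
  · intro z hz
    rw [notMem_compl_iff] at hz
    rw [hu.zero_outside _ hz.1, hu.zero_outside _ hz.2]
    simp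

/-- The equation satisfied by the difference of a solution and its reflection. -/
lemma form_sub_reflect_eq (hu : IsWeakSolution s Ω f g u) (hΩ : IsOpen Ω) (hν : ‖ν‖ = 1)
    (hR : ∀ x ∈ cap Ω ν l, reflect ν l x ∈ Ω) (hφ : MemHs s φ)
    (hM : ∀ᵐ x, |φ x| ≤ M) (hφ0 : ∀ᵐ x, x ∉ cap Ω ν l → φ x = 0) :
    Integrable (fun x => (source s Ω f g u x - source s Ω f g u (reflect ν l x)) * φ x) ∧
    (1 / 2) * fracConst N s * gagliardoForm s (fun x => u x - u (reflect ν l x)) φ =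
      ∫ x, (source s Ω f g u x - source s Ω f g u (reflect ν l x)) * φ x := by
  have mp := measurePreserving_reflect hν l
  have hφm := hφ.aestronglyMeasurable
  have hsrc := hu.integrable_source hΩ
  have i₁ : Integrable (fun x => source s Ω f g u x * φ x) := hsrc.mul_bdd (c := M) hφm hM
  have i₂ : Integrable (fun x => source s Ω f g u (reflect ν l x) * φ x) :=
    (mp.integrable_comp_of_integrable hsrc).mul_bdd (c := M) hφm hM
  simp only [sub_mul]
  refine ⟨i₁.sub i₂, ?_⟩
  have e₁ := hu.form_eq hΩ (φ := φ)
    ⟨hφ, hφ0.mono fun x hx hxΩ => hx fun hc => hxΩ hc.1⟩ hM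
  -- The reflected test function is admissible because the cap is mapped into Ω.
  have e₂ := hu.form_eq hΩ (φ := fun x => φ (reflect ν l x)) ⟨hφ.comp_reflect hν l, by
    filter_upwards [mp.quasiMeasurePreserving.ae hφ0] with x hx hxΩ
    refine hx fun hc => hxΩ ?_
    simpa only [reflect_reflect hν] using hR _ hc⟩ (mp.quasiMeasurePreserving.ae hM)
  have e₃ := integral_comp_reflect hν l
    (fun x => source s Ω f g u x * φ (reflect ν l x))
  simp only [reflect_reflect hν] at e₃
  rw [gagliardoForm_reflect hν, ← e₃] at e₂
  rw [integral_sub i₁ i₂, ← e₁, ← e₂, gagliardoForm_sub_left hu.memHs0.memHs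
    (hu.memHs0.memHs.comp_reflect hν l) hφ]
  ring

end IsWeakSolution

end WeakForm

/-! ### Maximum principle in sets of small measure. -/

/-- The hypotheses of the moving plane argument, for a solution that is nonnegative everywhere
(the pole included). -/
structure MovingPlaneData (s : ℝ) (Ω : Set (E N)) (f : E N → ℝ → ℝ) (g : ℝ → ℝ) (ν : E N)
    (u : E N → ℝ) : Prop where
  s_pos : 0 < s
  s_lt_one : s < 1
  isOpen : IsOpen Ω
  isBounded : Bornology.IsBounded Ω
  hypH1 : HypH1 Ω f g
  f_mono : ∀ x ∈ Ω, MonotoneOn (f x) (Ici 0)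
  g_mono : MonotoneOn g (Ici 0)
  g_nonneg : ∀ t : ℝ, 0 ≤ t → 0 ≤ g t
  norm_dir : ‖ν‖ = 1
  f_refl : ∀ l ≤ lambda10 Ω ν, ∀ x ∈ cap Ω ν l, ∀ t : ℝ, 0 ≤ t → f x t ≤ f (reflect ν l x) t
  sol : IsWeakSolution s Ω f g u
  cont : ContinuousOn u (closure Ω \ {0})
  nonneg : ∀ x, 0 ≤ u x

/-- `u` lies below its reflection in the cap. -/
def BelowReflection (Ω : Set (E N)) (ν : E N) (u : E N → ℝ) (l : ℝ) : Prop :=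
  ∀ x ∈ cap Ω ν l, reflect ν l x ≠ 0 → u x ≤ u (reflect ν l x)

namespace MovingPlaneData

variable {Ω : Set (E N)} {f : E N → ℝ → ℝ} {g : ℝ → ℝ} {ν : E N} {u : E N → ℝ} {l l₀ : ℝ}

lemma continuousAt (D : MovingPlaneData s Ω f g ν u) {x : E N} (hx : x ∈ Ω) (hx0 : x ≠ 0) :
    ContinuousAt u x := by
  have h : Ω \ {0} ∈ nhds x := (D.isOpen.sdiff isClosed_singleton).mem_nhds ⟨hx, hx0⟩
  exact D.cont.continuousAt (Filter.mem_of_superset h fun y hy => ⟨subset_closure hy.1, hy.2⟩)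

lemma reflect_mem (D : MovingPlaneData s Ω f g ν u) (hl : l < lambda10 Ω ν) {x : E N}
    (hx : x ∈ cap Ω ν l) : reflect ν l x ∈ Ω :=
  reflect_mem_of_mem_cap D.isBounded D.norm_dir (hl.trans_le (min_le_right _ _)) hx

lemma ne_zero_of_mem_cap (hl : l ≤ 0) {x : E N} (hx : x ∈ cap Ω ν l) : x ≠ 0 := by
  rintro rfl
  have := hx.2
  rw [inner_zero_left] at this
  linarith

lemma ae_reflect_ne_zero [Nontrivial (E N)] (D : MovingPlaneData s Ω f g ν u) (l : ℝ) :
    ∀ᵐ x : E N, reflect ν l x ≠ 0 :=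
  (measurePreserving_reflect D.norm_dir l).quasiMeasurePreserving.ae
    (compl_mem_ae_iff.2 (measure_singleton (0 : E N)))

lemma continuousAt_sub_reflect (D : MovingPlaneData s Ω f g ν u) (hl : l < lambda10 Ω ν)
    {x : E N} (hx : x ∈ cap Ω ν l) (hx0 : reflect ν l x ≠ 0) :
    ContinuousAt (fun p : ℝ × E N => u p.2 - u (reflect ν p.1 p.2)) (l, x) := by
  have h1 : ContinuousAt u x :=
    D.continuousAt hx.1 (ne_zero_of_mem_cap (hl.le.trans (min_le_left _ _)) hx)
  have h2 : ContinuousAt u (reflect ν l x) := D.continuousAt (D.reflect_mem hl hx) hx0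
  have h3 : ContinuousAt (fun p : ℝ × E N => u p.2) (l, x) :=
    ContinuousAt.comp (f := fun p : ℝ × E N => p.2) h1 continuousAt_snd
  have h4 : ContinuousAt (fun p : ℝ × E N => u (reflect ν p.1 p.2)) (l, x) :=
    ContinuousAt.comp (f := fun p : ℝ × E N => reflect ν p.1 p.2) h2
      continuous_reflect.continuousAt
  exact h3.sub h4

/-- For l < 0 the reflected point is closer to the pole, so g ≥ 0 allows its weight to be replaced
by that of x; `f_refl` does the same for f. -/
lemma source_sub_reflect_le (D : MovingPlaneData s Ω f g ν u) (hl : l < lambda10 Ω ν)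
    {x : E N} (hx : x ∈ cap Ω ν l) (hx0 : reflect ν l x ≠ 0) :
    source s Ω f g u x - source s Ω f g u (reflect ν l x) ≤
      (g (u x) - g (u (reflect ν l x))) / ‖x‖ ^ (2 * s) +
        (f x (u x) - f x (u (reflect ν l x))) := by
  have hl0 : l < 0 := hl.trans_le (min_le_left _ _)
  rw [source_of_mem hx.1, source_of_mem (D.reflect_mem hl hx)]
  have h1 := D.f_refl l hl.le x hx _ (D.nonneg (reflect ν l x))
  have h2 := D.g_nonneg _ (D.nonneg (reflect ν l x))
  have h3 : ‖reflect ν l x‖ ≤ ‖x‖ := by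
    rw [← sq_le_sq₀ (norm_nonneg _) (norm_nonneg _), norm_reflect_sq D.norm_dir]
    nlinarith [mul_pos (neg_pos.2 hl0) (sub_pos.2 hx.2)]
  have h4 : 0 < ‖reflect ν l x‖ := norm_pos_iff.2 hx0
  have hs := D.s_pos
  have h5 : g (u (reflect ν l x)) / ‖x‖ ^ (2 * s) ≤
      g (u (reflect ν l x)) / ‖reflect ν l x‖ ^ (2 * s) := by gcongr
  rw [sub_div]
  linarith

lemma source_le_source_reflect (D : MovingPlaneData s Ω f g ν u) (hl : l < lambda10 Ω ν)
    {x : E N} (hx : x ∈ cap Ω ν l) (hx0 : reflect ν l x ≠ 0) (hle : u x ≤ u (reflect ν l x)) :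
    source s Ω f g u x ≤ source s Ω f g u (reflect ν l x) := by
  have h := D.source_sub_reflect_le hl hx hx0
  have hg := D.g_mono (D.nonneg x) (D.nonneg _) hle
  have hf := D.f_mono x hx.1 (D.nonneg x) (D.nonneg _) hle
  have : (g (u x) - g (u (reflect ν l x))) / ‖x‖ ^ (2 * s) ≤ 0 :=
    div_nonpos_of_nonpos_of_nonneg (by linarith) (by positivity)
  linarith

/-- The pole lies strictly above the hyperplane at level l₀, so u is continuous on the compact part
of the closure of Ω below it. -/
lemma exists_bound (D : MovingPlaneData s Ω f g ν u) (hl₀ : l₀ < 0) :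
    ∃ M : ℝ, 0 < M ∧ ∀ x, inner ℝ x ν ≤ l₀ → u x ≤ M := by
  have hH : IsClosed {x : E N | inner ℝ x ν ≤ l₀} := isClosed_le (by fun_prop) continuous_const
  have hK : IsCompact (closure Ω ∩ {x : E N | inner ℝ x ν ≤ l₀}) :=
    D.isBounded.isCompact_closure.inter_right hH
  obtain ⟨M, hM⟩ := (hK.image_of_continuousOn (D.cont.mono fun x hx => ⟨hx.1, by
    rintro rfl
    have h : inner ℝ (0 : E N) ν ≤ l₀ := hx.2
    rw [inner_zero_left] at h
    linarith⟩)).bddAbove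
  refine ⟨max M 1, lt_of_lt_of_le one_pos (le_max_right _ _), fun x hx => ?_⟩
  by_cases hxΩ : x ∈ Ω
  · exact (hM (mem_image_of_mem u ⟨subset_closure hxΩ, hx⟩)).trans (le_max_left _ _)
  · rw [D.sol.zero_outside x hxΩ]
    exact zero_le_one.trans (le_max_right _ _)

/-- The Lipschitz bound for the difference of the sources at points where `u` exceeds its
reflection. -/
lemma exists_source_sub_le (D : MovingPlaneData s Ω f g ν u) (hl₀ : l₀ < lambda10 Ω ν) :
    ∃ C : ℝ, ∀ l ≤ l₀, ∀ x ∈ cap Ω ν l, reflect ν l x ≠ 0 → u (reflect ν l x) ≤ u x →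
      source s Ω f g u x - source s Ω f g u (reflect ν l x) ≤
        C * (u x - u (reflect ν l x)) := by
  have hl₀0 : l₀ < 0 := hl₀.trans_le (min_le_left _ _)
  have hs := D.s_pos
  obtain ⟨M, hM0, hM⟩ := D.exists_bound hl₀0
  obtain ⟨Lf, hLf⟩ := D.hypH1.lipschitz_f M hM0
  obtain ⟨Lg, hLg⟩ := D.hypH1.lipschitz_g M hM0
  -- The reflected point may be near the pole, but u(Rx) ≤ u(x) ≤ M keeps both values in the
  -- Lipschitz range. The denominator comes from |x| ≥ -l₀ on the cap; `|Lg|` is used because `Lg`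
  -- carries no sign.
  refine ⟨|Lg| / (-l₀) ^ (2 * s) + Lf, fun l hl x hx hx0 hle => ?_⟩
  have hxM := hM x (hx.2.le.trans hl)
  have m₁ : u x ∈ Icc 0 M := ⟨D.nonneg x, hxM⟩
  have m₂ : u (reflect ν l x) ∈ Icc 0 M := ⟨D.nonneg _, hle.trans hxM⟩
  have habs : |u x - u (reflect ν l x)| = u x - u (reflect ν l x) :=
    abs_of_nonneg (sub_nonneg.2 hle)
  have hf := (le_abs_self _).trans (hLf x hx.1 _ m₁ _ m₂)
  have hg := (le_abs_self _).trans (hLg _ m₁ _ m₂)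
  rw [habs] at hf hg
  have hg' : g (u x) - g (u (reflect ν l x)) ≤ |Lg| * (u x - u (reflect ν l x)) :=
    hg.trans (mul_le_mul_of_nonneg_right (le_abs_self _) (sub_nonneg.2 hle))
  have hnorm : -l₀ ≤ ‖x‖ := by
    have h1 := abs_real_inner_le_norm x ν
    rw [D.norm_dir, mul_one] at h1
    have h2 := neg_abs_le (inner ℝ x ν)
    have h3 := hx.2
    linarith
  have hpow : (-l₀) ^ (2 * s) ≤ ‖x‖ ^ (2 * s) :=
    Real.rpow_le_rpow (by linarith) hnorm (by linarith)
  have hpow0 : 0 < (-l₀) ^ (2 * s) := Real.rpow_pos_of_pos (by linarith) _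
  have hd := sub_nonneg.2 hle
  have hq : (g (u x) - g (u (reflect ν l x))) / ‖x‖ ^ (2 * s) ≤
      |Lg| * (u x - u (reflect ν l x)) / (-l₀) ^ (2 * s) :=
    calc _ ≤ |Lg| * (u x - u (reflect ν l x)) / ‖x‖ ^ (2 * s) := by gcongr
      _ ≤ _ := by gcongr
  refine (D.source_sub_reflect_le (hl.trans_lt hl₀) hx hx0).trans ?_
  rw [add_mul, div_mul_eq_mul_div]
  exact add_le_add hq hf

lemma sub_reflect_antisymm (D : MovingPlaneData s Ω f g ν u) (l : ℝ) (x : E N) :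
    u (reflect ν l x) - u (reflect ν l (reflect ν l x)) = -(u x - u (reflect ν l x)) := by
  rw [reflect_reflect D.norm_dir]; ring

lemma memHs_sub_reflect (D : MovingPlaneData s Ω f g ν u) (l : ℝ) :
    MemHs s (fun x => u x - u (reflect ν l x)) :=
  D.sol.memHs0.memHs.sub (D.sol.memHs0.memHs.comp_reflect D.norm_dir l)

/-- Maximum principle for sets of small measure. -/
lemma exists_belowReflection_of_small [Nontrivial (E N)] (D : MovingPlaneData s Ω f g ν u)
    (hl₀ : l₀ < lambda10 Ω ν) :
    ∃ τ : ℝ, 0 < τ ∧ ∀ l ≤ l₀, ∀ A : Set (E N), MeasurableSet A →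
      volume A ≤ ENNReal.ofReal τ →
      (∀ x ∈ cap Ω ν l, x ∉ A → reflect ν l x ≠ 0 → u x ≤ u (reflect ν l x)) →
      BelowReflection Ω ν u l := by
  have hν := D.norm_dir
  have hc : 0 < fracConst N s := fracConst_pos D.s_pos D.s_lt_one
  have hl₀0 : l₀ < 0 := hl₀.trans_le (min_le_left _ _)
  obtain ⟨M, hM0, hM⟩ := D.exists_bound hl₀0
  obtain ⟨C, hC⟩ := D.exists_source_sub_le hl₀
  -- With this constant, c/2 times the Poincaré bound is (C + c/2)∫φ², where c is `fracConst N s`;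
  -- this exceeds C∫φ² unless φ = 0. The threshold τ is uniform in l ≤ l₀, as the continuation step
  -- requires.
  obtain ⟨τ, hτ, hP⟩ := exists_poincare_of_small_measure (N := N) D.s_pos
    (2 * C / fracConst N s + 1)
  refine ⟨τ, hτ, fun l hl A hA hAτ hsub x hx hx0 => ?_⟩
  have hl10 : l < lambda10 Ω ν := hl.trans_lt hl₀
  set v : E N → ℝ := fun x => u x - u (reflect ν l x) with hv
  have hanti : ∀ x, v (reflect ν l x) = -v x := D.sub_reflect_antisymm l
  have hvH : MemHs s v := D.memHs_sub_reflect l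
  set φ := halfPos ν l v with hφdef
  have hφH : MemHs s φ := hvH.halfPos D.s_pos hν hanti
  have hφcap : ∀ x, x ∉ cap Ω ν l → φ x = 0 := by
    intro x hx
    rcases lt_trichotomy (inner ℝ x ν) l with h | h | h
    · have hxΩ : x ∉ Ω := fun h' => hx ⟨h', h⟩
      rw [hφdef, halfPos_of_le h.le, max_eq_right]
      simp only [hv, D.sol.zero_outside x hxΩ]
      linarith [D.nonneg (reflect ν l x)]
    · rw [hφdef, halfPos_of_le h.le, max_eq_right]
      simp [hv, reflect_eq_self h]
    · exact halfPos_of_lt h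
  have hφM : ∀ x, |φ x| ≤ M := by
    intro x
    rw [abs_of_nonneg (halfPos_nonneg x), halfPos]
    split_ifs with h
    · refine max_le ?_ hM0.le
      simp only [hv]
      linarith [hM x (h.trans hl), D.nonneg (reflect ν l x)]
    · exact hM0.le
  have hφA : ∀ᵐ x, x ∉ A → φ x = 0 := by
    filter_upwards [D.ae_reflect_ne_zero l] with x hx0 hxA
    by_cases hx : x ∈ cap Ω ν l
    · rw [hφdef, halfPos_of_le hx.2.le, max_eq_right]
      exact sub_nonpos.2 (hsub x hx hxA hx0)
    · exact hφcap x hx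
  obtain ⟨hint, heq⟩ := D.sol.form_sub_reflect_eq D.isOpen hν
    (fun x hx => D.reflect_mem hl10 hx) hφH (Filter.Eventually.of_forall hφM)
    (Filter.Eventually.of_forall hφcap)
  have hle : ∫ x, (source s Ω f g u x - source s Ω f g u (reflect ν l x)) * φ x ≤
      C * ∫ x, φ x ^ 2 := by
    rw [← integral_const_mul]
    refine integral_mono_ae hint (hφH.memLp.integrable_sq.const_mul C) ?_
    filter_upwards [D.ae_reflect_ne_zero l] with x hx0
    by_cases hx : x ∈ cap Ω ν l
    · have hφx : φ x = max (v x) 0 := halfPos_of_le hx.2.le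
      rcases le_total (v x) 0 with h | h
      · rw [hφx, max_eq_right h]; simp
      · rw [hφx, max_eq_left h]
        have := mul_le_mul_of_nonneg_right (hC l hl x hx hx0 (sub_nonneg.1 h)) h
        simp only [hv] at this ⊢
        linarith
    · rw [hφcap x hx]; simp
  have hB := gagliardoForm_halfPos_self_le D.s_pos hν hvH hanti
  have hPoin := hP A hA hAτ φ hφH hφA
  have hz : ∫ x, φ x ^ 2 ≤ 0 := by
    have h1 : (1 / 2) * fracConst N s * ((2 * C / fracConst N s + 1) * ∫ x, φ x ^ 2) ≤
        C * ∫ x, φ x ^ 2 :=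
      calc _ ≤ (1 / 2) * fracConst N s * gagliardoForm s v φ := by
            gcongr; exact hPoin.trans hB
        _ ≤ _ := heq.trans_le hle
    have h2 : (1 / 2) * fracConst N s * ((2 * C / fracConst N s + 1) * ∫ x, φ x ^ 2) =
        C * (∫ x, φ x ^ 2) + (1 / 2) * fracConst N s * ∫ x, φ x ^ 2 := by
      field_simp
    rw [h2] at h1
    by_contra h
    have := mul_pos (mul_pos one_half_pos hc) (not_le.1 h)
    linarith
  have hae : ∀ᵐ x, φ x = 0 := by
    have := (integral_eq_zero_iff_of_nonneg (fun x => sq_nonneg (φ x))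
      hφH.memLp.integrable_sq).1 (le_antisymm hz (integral_nonneg fun x => sq_nonneg (φ x)))
    filter_upwards [this] with x hx
    exact pow_eq_zero_iff two_ne_zero |>.1 hx
  by_contra hcon
  have hcont : ContinuousAt v x :=
    ContinuousAt.comp (f := fun y : E N => (l, y)) (D.continuousAt_sub_reflect hl10 hx hx0)
      (Continuous.prodMk_right l).continuousAt
  have hpos : 0 < v x := sub_pos.2 (not_le.1 hcon)
  obtain ⟨y, hy0, hyv, hyc⟩ := exists_of_ae_of_eventually hae
    ((hcont.eventually (lt_mem_nhds hpos)).and ((isOpen_cap D.isOpen).mem_nhds hx))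
  rw [hφdef, halfPos_of_le hyc.2.le] at hy0
  exact absurd hyv (not_lt.2 (max_eq_right_iff.1 hy0))

end MovingPlaneData

/-! ### The antisymmetric barrier. -/

/-- The antisymmetrized truncated paraboloid. -/
def oddBump (ν : E N) (l : ℝ) (c : E N) (r : ℝ) (x : E N) : ℝ :=
  bump c r x - bump c r (reflect ν l x)

section OddBump

variable {ν c : E N} {l r d : ℝ}

lemma oddBump_antisymm (hν : ‖ν‖ = 1) (x : E N) :
    oddBump ν l c r (reflect ν l x) = -oddBump ν l c r x := by
  rw [oddBump, oddBump, reflect_reflect hν]; ring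

lemma memHs_oddBump [Nontrivial (E N)] (hs0 : 0 < s) (hs1 : s < 1) (hν : ‖ν‖ = 1)
    (hr0 : 0 ≤ r) (hr1 : r ≤ 1) : MemHs s (oddBump ν l c r) :=
  (memHs_bump hs0 hs1 hr0 hr1).sub ((memHs_bump hs0 hs1 hr0 hr1).comp_reflect hν l)

lemma oddBump_le_bump (x : E N) : oddBump ν l c r x ≤ bump c r x :=
  sub_le_self _ (bump_nonneg _)

lemma abs_oddBump_le_one (hr0 : 0 ≤ r) (hr1 : r ≤ 1) (x : E N) : |oddBump ν l c r x| ≤ 1 := by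
  have h1 := bump_nonneg (c := c) (r := r) x
  have h2 := bump_nonneg (c := c) (r := r) (reflect ν l x)
  have h3 := bump_le_one (c := c) hr0 hr1 x
  have h4 := bump_le_one (c := c) hr0 hr1 (reflect ν l x)
  rw [oddBump, abs_le]
  constructor <;> linarith

lemma bump_reflect_eq_zero (hν : ‖ν‖ = 1) (hr0 : 0 ≤ r) (hd : 0 < d)
    (hB : ∀ x ∈ Metric.ball c r, inner ℝ x ν < l - d) {x : E N} (hx : inner ℝ x ν ≤ l) :
    bump c r (reflect ν l x) = 0 := by
  refine bump_of_notMem hr0 fun h => ?_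
  have := hB _ h
  rw [inner_reflect hν] at this
  linarith

/-- The reflected bump is subtracted, so its kinks have the wrong sign. Steps shorter than d do not
cross the hyperplane and never meet it; longer steps are covered by the crude bound 4, which is at
most 4|h|²/d². -/
lemma oddBump_second_difference_le (hν : ‖ν‖ = 1) (hr0 : 0 ≤ r) (hr1 : r ≤ 1) (hd : 0 < d)
    (hB : ∀ x ∈ Metric.ball c r, inner ℝ x ν < l - d) {x : E N} (hx : x ∈ Metric.ball c r)
    (h : E N) :
    2 * oddBump ν l c r x - oddBump ν l c r (h + x) - oddBump ν l c r (-h + x) ≤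
      (4 + 4 / d ^ 2) * min (‖h‖ ^ 2) 1 := by
  have hxl := hB x hx
  have hin : ∀ w : E N, ‖w‖ < d → bump c r (reflect ν l (w + x)) = 0 := by
    intro w hw
    refine bump_reflect_eq_zero hν hr0 hd hB ?_
    have h1 := (le_abs_self _).trans (abs_real_inner_le_norm w ν)
    rw [hν, mul_one] at h1
    rw [inner_add_left]
    linarith
  have h2 := bump_second_difference_le (c := c) (r := r) x h
  have p0 := bump_nonneg (c := c) (r := r) (reflect ν l x)
  have habs := fun y => abs_le.1 (abs_oddBump_le_one (ν := ν) (l := l) (c := c) hr0 hr1 y)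
  have hcrude : 2 * oddBump ν l c r x - oddBump ν l c r (h + x) - oddBump ν l c r (-h + x) ≤ 4 := by
    linarith [(habs x).2, (habs (h + x)).1, (habs (-h + x)).1]
  have hd2 : 0 < 4 / d ^ 2 := by positivity
  rcases le_total 1 ‖h‖ with h1 | h1
  · rw [min_eq_right (one_le_pow₀ h1)]
    linarith
  · rw [min_eq_left (pow_le_one₀ (norm_nonneg h) h1)]
    rcases lt_or_ge ‖h‖ d with hhd | hhd
    · have e1 := hin h hhd
      have e2 := hin (-h) (by rwa [norm_neg])
      simp only [oddBump, e1, e2]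
      nlinarith [mul_nonneg hd2.le (sq_nonneg ‖h‖), sq_nonneg ‖h‖]
    · have hsq : d ^ 2 ≤ ‖h‖ ^ 2 := by gcongr
      have : 4 ≤ 4 / d ^ 2 * ‖h‖ ^ 2 := by
        rw [div_mul_eq_mul_div, le_div_iff₀ (by positivity)]
        linarith
      nlinarith [sq_nonneg ‖h‖]

end OddBump

/-! ### Strong maximum principle. -/

namespace MovingPlaneData

variable {Ω : Set (E N)} {f : E N → ℝ → ℝ} {g : ℝ → ℝ} {ν : E N} {u : E N → ℝ} {l l₀ : ℝ}

lemma ae_sub_reflect_nonpos [Nontrivial (E N)] (D : MovingPlaneData s Ω f g ν u)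
    (hP : BelowReflection Ω ν u l) :
    ∀ᵐ x : E N, inner ℝ x ν ≤ l → u x - u (reflect ν l x) ≤ 0 := by
  filter_upwards [D.ae_reflect_ne_zero l] with x hx0 hxl
  rcases hxl.eq_or_lt with h | h
  · rw [reflect_eq_self h, sub_self]
  · by_cases hx : x ∈ Ω
    · exact sub_nonpos.2 (hP x ⟨hx, h⟩ hx0)
    · rw [D.sol.zero_outside x hx]
      linarith [D.nonneg (reflect ν l x)]

/-- Two balls, one around a point of the cap and one below the domain, on which all quantities
entering the strong maximum principle are controlled. -/
lemma exists_balls (D : MovingPlaneData s Ω f g ν u) (hl : l < lambda10 Ω ν) {x₀ : E N}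
    (hx₀ : x₀ ∈ cap Ω ν l) :
    ∃ (y₀ : E N) (r d k : ℝ), 0 < r ∧ r ≤ 1 ∧ 0 < d ∧ 0 < k ∧
      Metric.ball x₀ r ⊆ cap Ω ν l ∧ (∀ x ∈ Metric.ball x₀ r, inner ℝ x ν < l - d) ∧
      (∀ y ∈ Metric.ball y₀ r, y ∉ Ω ∧ inner ℝ y ν < l) ∧
      ∀ x ∈ Metric.ball x₀ r, ∀ y ∈ Metric.ball y₀ r,
        k ≤ u (reflect ν l y) * ((‖x - y‖ ^ ((N : ℝ) + 2 * s))⁻¹ -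
          (‖x - reflect ν l y‖ ^ ((N : ℝ) + 2 * s))⁻¹) := by
  have hν := D.norm_dir
  have hs := D.s_pos
  have hax := aInf_le D.isBounded hν hx₀.1
  have hxl := hx₀.2
  obtain ⟨y₀, hy₀a, hy₀Ω, hy₀0⟩ := exists_below_reflect_mem D.isBounded ⟨x₀, hx₀.1⟩ hν
    (hl.trans_le (min_le_right _ _)) (hax.trans hxl.le)
  have hyl : inner ℝ y₀ ν < l := by linarith
  set p : ℝ := (N : ℝ) + 2 * s with hp
  have hp0 : 0 < p := by positivity
  -- Positive at (x₀, y₀), since u > 0 at R y₀ and x₀ is strictly closer to y₀ than to R y₀; by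
  -- continuity at least half that value persists on small balls.
  set F : E N × E N → ℝ := fun z =>
    u (reflect ν l z.2) * ((‖z.1 - z.2‖ ^ p)⁻¹ - (‖z.1 - reflect ν l z.2‖ ^ p)⁻¹) with hF
  have hlt := norm_sub_lt_norm_sub_reflect hν hxl hyl
  have hne : 0 < ‖x₀ - y₀‖ := by
    refine norm_pos_iff.2 (sub_ne_zero.2 ?_)
    rintro rfl
    linarith
  have hFpos : 0 < F (x₀, y₀) := by
    refine mul_pos (D.sol.pos _ hy₀Ω hy₀0) (sub_pos.2 ?_)
    simp only
    gcongr
  have hRc := continuous_reflect_right (ν := ν) l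
  have hFc : ContinuousAt F (x₀, y₀) := by
    have c1 : ContinuousAt (fun z : E N × E N => u (reflect ν l z.2)) (x₀, y₀) :=
      ContinuousAt.comp (f := fun z : E N × E N => reflect ν l z.2)
        (D.continuousAt hy₀Ω hy₀0) (hRc.comp continuous_snd).continuousAt
    have c2 : ContinuousAt (fun z : E N × E N => ‖z.1 - z.2‖ ^ p) (x₀, y₀) :=
      ContinuousAt.rpow_const (by fun_prop) (Or.inl hne.ne')
    have c3 : ContinuousAt (fun z : E N × E N => ‖z.1 - reflect ν l z.2‖ ^ p) (x₀, y₀) :=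
      ContinuousAt.rpow_const
        (continuous_fst.sub (hRc.comp continuous_snd)).norm.continuousAt
        (Or.inl (hne.trans hlt).ne')
    exact c1.mul ((c2.inv₀ (Real.rpow_pos_of_pos hne p).ne').sub
      (c3.inv₀ (Real.rpow_pos_of_pos (hne.trans hlt) p).ne'))
  set d := (l - inner ℝ x₀ ν) / 2 with hd
  have hd0 : 0 < d := by rw [hd]; linarith
  have hopen : ∀ t : ℝ, IsOpen {x : E N | inner ℝ x ν < t} := fun t =>
    isOpen_lt (by fun_prop) continuous_const
  have e1 : ∀ᶠ x in nhds x₀, x ∈ cap Ω ν l ∧ inner ℝ x ν < l - d :=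
    Filter.Eventually.and ((isOpen_cap D.isOpen).mem_nhds hx₀)
      ((hopen (l - d)).mem_nhds (show inner ℝ x₀ ν < l - d by rw [hd]; linarith))
  have e2 : ∀ᶠ y in nhds y₀, inner ℝ y ν < aInf Ω ν := (hopen _).mem_nhds hy₀a
  have e3 : ∀ᶠ z in nhds (x₀, y₀), F (x₀, y₀) / 2 < F z :=
    hFc.eventually (lt_mem_nhds (half_lt_self hFpos))
  obtain ⟨r, hr, hball⟩ := Metric.eventually_nhds_iff_ball.1
    ((e1.prod_nhds e2).and e3)
  refine ⟨y₀, min r 1, d, F (x₀, y₀) / 2, lt_min hr one_pos, min_le_right _ _, hd0,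
    half_pos hFpos, ?_⟩
  have hb : ∀ x ∈ Metric.ball x₀ (min r 1), ∀ y ∈ Metric.ball y₀ (min r 1),
      (x, y) ∈ Metric.ball (x₀, y₀) r := by
    intro x hx y hy
    rw [← ball_prod_same]
    exact ⟨Metric.ball_subset_ball (min_le_left _ _) hx,
      Metric.ball_subset_ball (min_le_left _ _) hy⟩
  have hx₀b := Metric.mem_ball_self (x := x₀) (lt_min hr one_pos)
  have hy₀b := Metric.mem_ball_self (x := y₀) (lt_min hr one_pos)
  refine ⟨fun x hx => (hball _ (hb x hx y₀ hy₀b)).1.1.1,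
    fun x hx => (hball _ (hb x hx y₀ hy₀b)).1.1.2, fun y hy => ?_,
    fun x hx y hy => (hball _ (hb x hx y hy)).2.le⟩
  have hya : inner ℝ y ν < aInf Ω ν := (hball _ (hb x₀ hx₀b y hy)).1.2
  exact ⟨fun h => absurd (aInf_le D.isBounded hν h) (not_le.2 hya), by linarith⟩

/-- Strong maximum principle. -/
lemma lt_reflect_of_belowReflection [Nontrivial (E N)] (D : MovingPlaneData s Ω f g ν u)
    (hl : l < lambda10 Ω ν) (hP : BelowReflection Ω ν u l) {x₀ : E N} (hx₀ : x₀ ∈ cap Ω ν l)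
    (hx₀0 : reflect ν l x₀ ≠ 0) : u x₀ < u (reflect ν l x₀) := by
  have hν := D.norm_dir
  have hc : 0 < fracConst N s := fracConst_pos D.s_pos D.s_lt_one
  obtain ⟨y₀, r, d, k, hr0, hr1, hd, hk, hBcap, hBd, hUout, hgain⟩ := D.exists_balls hl hx₀
  set B := Metric.ball x₀ r with hBdef
  set U := Metric.ball y₀ r with hUdef
  have hBm : MeasurableSet B := Metric.isOpen_ball.measurableSet
  have hU0 : 0 < volume.real U :=
    ENNReal.toReal_pos (Metric.measure_ball_pos _ _ hr0).ne' measure_ball_lt_top.ne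
  obtain ⟨Q, hQ⟩ : ∃ Q : ℝ, Q = (4 + 4 / d ^ 2) *
      ∫ h : E N, min (‖h‖ ^ 2) 1 / ‖h‖ ^ ((N : ℝ) + 2 * s) := ⟨_, rfl⟩
  have hQ0 : 0 ≤ Q := by
    rw [hQ]
    exact mul_nonneg (by positivity) (integral_nonneg fun h => by positivity)
  -- The cost εQ of the barrier must stay below the nonlocal gain k|U|.
  obtain ⟨ε, hε0, hεQ⟩ : ∃ ε : ℝ, 0 < ε ∧ ε * Q < k * volume.real U := by
    have hG : 0 < k * volume.real U := mul_pos hk hU0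
    refine ⟨k * volume.real U / (Q + 1), div_pos hG (by linarith), ?_⟩
    rw [div_mul_eq_mul_div, div_lt_iff₀ (by linarith)]
    exact mul_lt_mul_of_pos_left (by linarith) hG
  set ζ := oddBump ν l x₀ r with hζ
  have hζH : MemHs s ζ := memHs_oddBump D.s_pos D.s_lt_one hν hr0.le hr1
  set v : E N → ℝ := fun x => u x - u (reflect ν l x) with hv
  have hvH : MemHs s v := D.memHs_sub_reflect l
  set ψ : E N → ℝ := fun x => ε * ζ x + v x with hψ
  have hψH : MemHs s ψ := (hζH.const_mul ε).add hvH
  have hanti : ∀ x, ψ (reflect ν l x) = -ψ x := by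
    intro x
    have h1 : ζ (reflect ν l x) = -ζ x := oddBump_antisymm hν x
    have h2 : v (reflect ν l x) = -v x := D.sub_reflect_antisymm l x
    simp only [hψ, h1, h2]
    ring
  set φ := halfPos ν l ψ with hφ
  have hφH : MemHs s φ := hψH.halfPos D.s_pos hν hanti
  -- Since v ≤ 0 in the half-space, φ lies under the barrier, hence is bounded and vanishes outside
  -- B.
  have hφle : ∀ᵐ x, φ x ≤ ε * bump x₀ r x := by
    filter_upwards [D.ae_sub_reflect_nonpos hP] with x hx
    rw [hφ, halfPos]
    split_ifs with h
    · refine max_le ?_ (mul_nonneg hε0.le (bump_nonneg x))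
      have h1 := mul_le_mul_of_nonneg_left (oddBump_le_bump (ν := ν) (l := l) (c := x₀) (r := r) x)
        hε0.le
      have h2 := hx h
      simp only [hψ, hζ, hv]
      linarith
    · exact mul_nonneg hε0.le (bump_nonneg x)
  have hφB : ∀ᵐ x, x ∉ B → φ x = 0 := by
    filter_upwards [hφle] with x hx hxB
    rw [bump_of_notMem hr0.le hxB, mul_zero] at hx
    exact le_antisymm hx (halfPos_nonneg x)
  have hφε : ∀ᵐ x, |φ x| ≤ ε := by
    filter_upwards [hφle] with x hx
    rw [abs_of_nonneg (halfPos_nonneg x)]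
    exact hx.trans (mul_le_of_le_one_right hε0.le (bump_le_one hr0.le hr1 x))
  have hφi : Integrable φ := by
    have hBi : Integrable (B.indicator fun _ => ε) :=
      (integrable_indicator_iff hBm).2 (integrableOn_const measure_ball_lt_top.ne)
    refine hBi.mono' hφH.aestronglyMeasurable ?_
    filter_upwards [hφB, hφε] with x h1 h2
    by_cases hx : x ∈ B
    · rw [indicator_of_mem hx]; exact h2
    · rw [indicator_of_notMem hx, h1 hx, norm_zero]
  obtain ⟨-, heq⟩ := D.sol.form_sub_reflect_eq D.isOpen hν
    (fun x hx => D.reflect_mem hl hx) hφH hφε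
    (hφB.mono fun x hx hxc => hx fun hxB => hxc (hBcap hxB))
  have hvφ : gagliardoForm s v φ ≤ 0 := by
    have hsrc : ∫ x, (source s Ω f g u x - source s Ω f g u (reflect ν l x)) * φ x ≤ 0 := by
      refine integral_nonpos_of_ae ?_
      filter_upwards [hφB, D.ae_reflect_ne_zero l] with x h1 h2
      by_cases hx : x ∈ B
      · exact mul_nonpos_of_nonpos_of_nonneg (sub_nonpos.2
          (D.source_le_source_reflect hl (hBcap hx) h2 (hP x (hBcap hx) h2))) (halfPos_nonneg x)
      · rw [h1 hx]; simp
    rw [← heq] at hsrc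
    by_contra h
    have := mul_pos (mul_pos one_half_pos hc) (not_le.1 h)
    linarith
  have hζφ : gagliardoForm s ζ φ ≤ Q * ∫ x, φ x := by
    rw [hQ]
    exact gagliardoForm_le_of_second_difference_le D.s_pos D.s_lt_one hζH hφH
      (B := B) (abs_oddBump_le_one hr0.le hr1) (fun x => halfPos_nonneg x) hφi hφB
      fun x hx h => oddBump_second_difference_le hν hr0.le hr1 hd hBd hx h
  have hψU : ∀ y ∈ U, u (reflect ν l y) ≤ -ψ y := by
    intro y hy
    have h1 : bump x₀ r y = 0 := bump_of_notMem hr0.le fun h => (hUout y hy).1 (hBcap h).1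
    have h2 := mul_nonneg hε0.le (bump_nonneg (c := x₀) (r := r) (reflect ν l y))
    simp only [hψ, hζ, hv, oddBump, h1, D.sol.zero_outside y (hUout y hy).1]
    linarith
  have hlow := mul_setIntegral_le_gagliardoForm_halfPos D.s_pos hν hψH hanti (B := B) (U := U)
    (k := k) hφi.integrableOn hBm Metric.isOpen_ball.measurableSet measure_ball_lt_top.ne
    (fun y hy => (hUout y hy).2)
    (fun x hx y hy => (hgain x hx y hy).trans (mul_le_mul_of_nonneg_right (hψU y hy)
      (sub_nonneg.2 (inv_rpow_norm_sub_reflect_le D.s_pos hν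
        (fun h => (hUout y hy).1 (h ▸ (hBcap hx).1)) (hBcap hx).2.le (hUout y hy).2.le))))
    (fun y hy => by linarith [hψU y hy, D.nonneg (reflect ν l y)])
  rw [setIntegral_eq_integral_of_ae_compl_eq_zero hφB,
    gagliardoForm_add_left (hζH.const_mul ε) hvH hφH, gagliardoForm_const_mul_left] at hlow
  -- The gain and the cost combine to k|U|∫φ ≤ εQ∫φ, while εQ < k|U|.
  have hz : ∫ x, φ x ≤ 0 := by
    by_contra h
    have h1 := mul_lt_mul_of_pos_right hεQ (not_le.1 h)
    have h2 := mul_le_mul_of_nonneg_left hζφ hε0.le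
    linarith
  have hae : ∀ᵐ x, φ x = 0 :=
    (integral_eq_zero_iff_of_nonneg (fun x => halfPos_nonneg x) hφi).1
      (le_antisymm hz (integral_nonneg fun x => halfPos_nonneg x))
  by_contra hcon
  have hcont : ContinuousAt ψ x₀ := by
    have h1 : ContinuousAt v x₀ :=
      ContinuousAt.comp (f := fun y : E N => (l, y)) (D.continuousAt_sub_reflect hl hx₀ hx₀0)
        (Continuous.prodMk_right l).continuousAt
    have h2 : Continuous ζ :=
      continuous_bump.sub (continuous_bump.comp (continuous_reflect_right l))
    exact (h2.continuousAt.const_mul ε).add h1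
  -- If v(x₀) ≥ 0, the barrier lifts ψ(x₀) to at least εr².
  have hpos : 0 < ψ x₀ := by
    have h1 : bump x₀ r (reflect ν l x₀) = 0 :=
      bump_reflect_eq_zero hν hr0.le hd hBd hx₀.2.le
    have h2 : bump x₀ r x₀ = r ^ 2 := by simp [bump, sq_nonneg]
    have h3 : 0 < ε * r ^ 2 := by positivity
    simp only [hψ, hζ, hv, oddBump, h1, h2, sub_zero]
    linarith [not_lt.1 hcon]
  obtain ⟨y, hy0, hyv, hyc⟩ := exists_of_ae_of_eventually hae
    ((hcont.eventually (lt_mem_nhds hpos)).and ((isOpen_cap D.isOpen).mem_nhds hx₀))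
  rw [hφ, halfPos_of_le hyc.2.le] at hy0
  exact absurd hyv (not_lt.2 (max_eq_right_iff.1 hy0))

end MovingPlaneData

/-! ### Moving the plane. -/

namespace MovingPlaneData

variable {Ω : Set (E N)} {f : E N → ℝ → ℝ} {g : ℝ → ℝ} {ν : E N} {u : E N → ℝ} {l l₀ : ℝ}

lemma belowReflection_of_le_aInf (D : MovingPlaneData s Ω f g ν u) (hl : l ≤ aInf Ω ν) :
    BelowReflection Ω ν u l := fun _ hx _ =>
  absurd (aInf_le D.isBounded D.norm_dir hx.1) (not_le.2 (hx.2.trans_le hl))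

/-- Membership of x in the cap and R_l x ≠ 0 are open conditions on l, so they hold along a
converging sequence of levels and the inequality passes to the limit. -/
lemma isClosed_belowReflection (D : MovingPlaneData s Ω f g ν u) (hl₀ : l₀ < lambda10 Ω ν)
    (a : ℝ) : IsClosed ({l | BelowReflection Ω ν u l} ∩ Icc a l₀) := by
  refine IsSeqClosed.isClosed fun t l ht htl => ?_
  have hl : l ∈ Icc a l₀ := isClosed_Icc.mem_of_tendsto htl
    (Filter.Eventually.of_forall fun n => (ht n).2)
  refine ⟨fun x hx hx0 => ?_, hl⟩
  have hcont := D.continuousAt_sub_reflect (hl.2.trans_lt hl₀) hx hx0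
  have hpair : Filter.Tendsto (fun n => (t n, x)) Filter.atTop (nhds (l, x)) :=
    htl.prodMk_nhds tendsto_const_nhds
  have hlim := hcont.tendsto.comp hpair
  have hRlim : Filter.Tendsto (fun n => reflect ν (t n) x) Filter.atTop
      (nhds (reflect ν l x)) :=
    (continuous_reflect.tendsto (l, x)).comp hpair
  refine sub_nonpos.1 (le_of_tendsto hlim ?_)
  filter_upwards [htl.eventually (lt_mem_nhds hx.2), hRlim.eventually_ne hx0] with n h1 h2
  exact sub_nonpos.2 ((ht n).1 x ⟨hx.1, h1⟩ h2)

lemma belowReflection_mem_nhdsGT [Nontrivial (E N)] (D : MovingPlaneData s Ω f g ν u)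
    (hl₀ : l₀ < lambda10 Ω ν) (hl : l < l₀) (hP : BelowReflection Ω ν u l) :
    {l | BelowReflection Ω ν u l} ∈ nhdsWithin l (Ioi l) := by
  have hν := D.norm_dir
  obtain ⟨τ, hτ, hsmall⟩ := D.exists_belowReflection_of_small hl₀
  -- The strict inequality is unavailable on the hyperplane and at the point reflected to the pole;
  -- both are null sets, so a compact K in the remainder still fills Ω up to measure τ.
  set S : Set (E N) := (Ω \ {x | inner ℝ x ν = l}) \ {reflect ν l 0} with hS
  have hHc : IsClosed {x : E N | inner ℝ x ν = l} := isClosed_eq (by fun_prop) continuous_const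
  have hSo : IsOpen S := (D.isOpen.sdiff hHc).sdiff isClosed_singleton
  have hSfin : volume S ≠ ⊤ :=
    ne_top_of_le_ne_top D.isBounded.measure_lt_top.ne
      (measure_mono (sdiff_subset.trans sdiff_subset))
  obtain ⟨K, hKS, hK, hKτ⟩ := hSo.measurableSet.exists_isCompact_sdiff_lt hSfin
    (ENNReal.ofReal_pos.2 hτ).ne'
  have hAm : MeasurableSet (Ω \ K) := D.isOpen.measurableSet.diff hK.measurableSet
  have hA : volume (Ω \ K) ≤ ENNReal.ofReal τ := by
    have hsub : Ω \ K ⊆ (S \ K) ∪ ({x | inner ℝ x ν = l} ∪ {reflect ν l 0}) := by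
      intro x hx
      by_cases h1 : x ∈ {x : E N | inner ℝ x ν = l}
      · exact Or.inr (Or.inl h1)
      · by_cases h2 : x ∈ ({reflect ν l 0} : Set (E N))
        · exact Or.inr (Or.inr h2)
        · exact Or.inl ⟨⟨⟨hx.1, h1⟩, h2⟩, hx.2⟩
    have hnull : volume ({x | inner ℝ x ν = l} ∪ {reflect ν l 0} : Set (E N)) = 0 :=
      measure_union_null (volume_hyperplane hν l) (measure_singleton _)
    calc volume (Ω \ K) ≤ volume (S \ K) +
          volume ({x | inner ℝ x ν = l} ∪ {reflect ν l 0} : Set (E N)) :=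
          (measure_mono hsub).trans (measure_union_le _ _)
      _ ≤ ENNReal.ofReal τ := by rw [hnull, add_zero]; exact hKτ.le
  -- Compactness of K makes the neighbourhood of l uniform. Below the hyperplane the strict
  -- inequality persists; points above it lie outside nearby caps.
  have hev : ∀ᶠ m in nhds l, ∀ x ∈ K, x ∈ cap Ω ν m → u x ≤ u (reflect ν m x) := by
    refine hK.eventually_forall_of_forall_eventually fun x hx => ?_
    obtain ⟨⟨hxΩ, hxl⟩, hxR⟩ := hKS hx
    have hxl' : inner ℝ x ν ≠ l := hxl
    rcases lt_or_gt_of_ne hxl' with h | h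
    · have hx0 : reflect ν l x ≠ 0 := by
        intro h0
        refine hxR ?_
        rw [mem_singleton_iff, ← h0, reflect_reflect hν]
      have hlt := D.lt_reflect_of_belowReflection (hl.trans hl₀) hP ⟨hxΩ, h⟩ hx0
      have hc := D.continuousAt_sub_reflect (hl.trans hl₀) ⟨hxΩ, h⟩ hx0
      filter_upwards [hc.eventually (gt_mem_nhds (sub_neg.2 hlt))] with z hz _
      exact (sub_neg.1 hz).le
    · have ho : IsOpen {z : ℝ × E N | z.1 < inner ℝ z.2 ν} :=
        isOpen_lt continuous_fst (by fun_prop)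
      filter_upwards [ho.mem_nhds (show (l, x) ∈ {z : ℝ × E N | z.1 < inner ℝ z.2 ν} from h)]
        with z hz hzc
      exact absurd hzc.2 (not_lt.2 (le_of_lt hz))
  refine mem_nhdsWithin_of_mem_nhds ?_
  filter_upwards [hev, gt_mem_nhds hl] with m hm hml₀
  exact hsmall m hml₀.le _ hAm hA fun x hx hxA _ =>
    hm x (by_contra fun h => hxA ⟨hx.1, h⟩) hx

theorem belowReflection [Nontrivial (E N)] (D : MovingPlaneData s Ω f g ν u)
    (hl : l < lambda10 Ω ν) : BelowReflection Ω ν u l := by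
  rcases le_total l (aInf Ω ν) with hla | hla
  · exact D.belowReflection_of_le_aInf hla
  · exact IsClosed.Icc_subset_of_forall_mem_nhdsWithin (D.isClosed_belowReflection hl _)
      (D.belowReflection_of_le_aInf le_rfl)
      (fun m hm => D.belowReflection_mem_nhdsGT hl hm.2.2 hm.1) (right_mem_Icc.2 hla)

theorem lt_reflect [Nontrivial (E N)] (D : MovingPlaneData s Ω f g ν u)
    (hl : l < lambda10 Ω ν) {x : E N} (hx : x ∈ cap Ω ν l) (hx0 : reflect ν l x ≠ 0) :
    u x < u (reflect ν l x) :=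
  D.lt_reflect_of_belowReflection hl (D.belowReflection hl) hx hx0

/-- At l = λ₁⁰ the reflected point is only known to lie in the closure of Ω, so l is approached from
below using continuity of u up to the boundary. -/
theorem le_reflect [Nontrivial (E N)] (D : MovingPlaneData s Ω f g ν u)
    (hl : l ≤ lambda10 Ω ν) {x : E N} (hx : x ∈ cap Ω ν l) (hx0 : reflect ν l x ≠ 0) :
    u x ≤ u (reflect ν l x) := by
  have hR : Filter.Tendsto (fun m => reflect ν m x) (nhdsWithin l (Iio l))
      (nhds (reflect ν l x)) :=
    ((continuous_reflect.comp (Continuous.prodMk_left x)).tendsto l).mono_left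
      nhdsWithin_le_nhds
  have hev : ∀ᶠ m in nhdsWithin l (Iio l), m < l ∧ x ∈ cap Ω ν m ∧ reflect ν m x ≠ 0 := by
    filter_upwards [self_mem_nhdsWithin, mem_nhdsWithin_of_mem_nhds (lt_mem_nhds hx.2),
      hR.eventually_ne hx0] with m h1 h2 h3
    exact ⟨h1, ⟨hx.1, h2⟩, h3⟩
  have hmem : ∀ᶠ m in nhdsWithin l (Iio l), reflect ν m x ∈ closure Ω \ {0} :=
    hev.mono fun m hm => ⟨subset_closure (D.reflect_mem (hm.1.trans_le hl) hm.2.1), hm.2.2⟩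
  have hcl : reflect ν l x ∈ closure Ω \ {0} :=
    ⟨isClosed_closure.mem_of_tendsto hR (hmem.mono fun m hm => hm.1), hx0⟩
  have hlim := (D.cont _ hcl).tendsto.comp (tendsto_nhdsWithin_iff.2 ⟨hR, hmem⟩)
  exact ge_of_tendsto hlim (hev.mono fun m hm =>
    D.belowReflection (hm.1.trans_le hl) x hm.2.1 hm.2.2)

end MovingPlaneData

/-! ### The value at the pole, and the conclusion. -/

lemma IsWeakSolution.abs_eq {Ω : Set (E N)} {f : E N → ℝ → ℝ} {g : ℝ → ℝ} {u : E N → ℝ}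
    (hu : IsWeakSolution s Ω f g u) {x : E N} (hx : x ≠ 0) : |u x| = u x := by
  by_cases hxΩ : x ∈ Ω
  · exact abs_of_pos (hu.pos x hxΩ hx)
  · rw [hu.zero_outside x hxΩ, abs_zero]

/-- The value of a weak solution at the pole is irrelevant, and may be assumed nonnegative. -/
lemma IsWeakSolution.abs [Nontrivial (E N)] {Ω : Set (E N)} {f : E N → ℝ → ℝ} {g : ℝ → ℝ}
    {u : E N → ℝ} (hu : IsWeakSolution s Ω f g u) :
    IsWeakSolution s Ω f g (fun x => |u x|) := by
  have h0 : ∀ᵐ x : E N, x ≠ 0 := compl_mem_ae_iff.2 (measure_singleton 0)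
  have hae : ∀ᵐ x, u x = |u x| := h0.mono fun x hx => (hu.abs_eq hx).symm
  have h1 : ∀ᵐ z : E N × E N, u z.1 = |u z.1| :=
    (Measure.quasiMeasurePreserving_fst (μ := volume) (ν := volume)).ae hae
  have h2 : ∀ᵐ z : E N × E N, u z.2 = |u z.2| :=
    (Measure.quasiMeasurePreserving_snd (μ := volume) (ν := volume)).ae hae
  have haeΩ : ∀ᵐ x ∂(volume.restrict Ω), u x = |u x| := ae_restrict_of_ae hae
  refine ⟨⟨⟨hu.memHs0.memHs.memLp.ae_eq hae, hu.memHs0.memHs.gagliardo.congr ?_⟩, ?_⟩,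
    fun x hx hx0 => abs_pos_of_pos (hu.pos x hx hx0), fun x hx => ?_,
    hu.integrable_g.congr ?_, hu.integrable_f.congr ?_, fun φ hφ hφ' => ?_⟩
  · filter_upwards [h1, h2] with z e1 e2
    rw [← e1, ← e2]
  · exact Filter.Eventually.of_forall fun x hx => by rw [hu.zero_outside x hx, abs_zero]
  · rw [hu.zero_outside x hx, abs_zero]
  · filter_upwards [haeΩ] with x hx
    rw [← hx]
  · filter_upwards [haeΩ] with x hx
    rw [← hx]
  · have e1 : ∫ z in (Ωᶜ ×ˢ Ωᶜ)ᶜ, (|u z.1| - |u z.2|) * (φ z.1 - φ z.2) /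
        ‖z.1 - z.2‖ ^ ((N : ℝ) + 2 * s) = ∫ z in (Ωᶜ ×ˢ Ωᶜ)ᶜ, (u z.1 - u z.2) *
        (φ z.1 - φ z.2) / ‖z.1 - z.2‖ ^ ((N : ℝ) + 2 * s) := by
      refine integral_congr_ae ?_
      filter_upwards [ae_restrict_of_ae h1, ae_restrict_of_ae h2] with z e1 e2
      rw [← e1, ← e2]
    have e2 : ∫ x in Ω, g |u x| / ‖x‖ ^ (2 * s) * φ x =
        ∫ x in Ω, g (u x) / ‖x‖ ^ (2 * s) * φ x := by
      refine integral_congr_ae ?_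
      filter_upwards [haeΩ] with x hx
      rw [← hx]
    have e3 : ∫ x in Ω, f x |u x| * φ x = ∫ x in Ω, f x (u x) * φ x := by
      refine integral_congr_ae ?_
      filter_upwards [haeΩ] with x hx
      rw [← hx]
    rw [e1, e2, e3]
    exact hu.weak_eq φ hφ hφ'

end FractionalHardy

end

open FractionalHardy

theorem mainTheorem3 {N : ℕ} {s : ℝ} (hs0 : 0 < s) (hs1 : s < 1) (hN : 2 * s < (N : ℝ))
    {Ω : Set (E N)} (hΩ : IsBoundedSmoothDomain Ω) (h0 : (0 : E N) ∈ Ω)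
    {f : E N → ℝ → ℝ} {g : ℝ → ℝ} (hH1 : HypH1 Ω f g)
    (hf_mono : ∀ x ∈ Ω, MonotoneOn (f x) (Set.Ici 0))
    (hg_mono : MonotoneOn g (Set.Ici 0))
    (hg_nonneg : ∀ t : ℝ, 0 ≤ t → 0 ≤ g t)
    {ν : E N} (hν : ‖ν‖ = 1)
    (hf_refl : ∀ l ≤ lambda10 Ω ν, ∀ x ∈ cap Ω ν l, ∀ t : ℝ, 0 ≤ t →
      f x t ≤ f (reflect ν l x) t)
    {u : E N → ℝ} (hu : IsWeakSolution s Ω f g u)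
    (hu_cont : ContinuousOn u (closure Ω \ {0})) :
    ∀ l : ℝ, aInf Ω ν ≤ l → l ≤ lambda10 Ω ν →
      (∀ x ∈ cap Ω ν l, reflect ν l x ≠ 0 → u x ≤ u (reflect ν l x)) ∧
      (∀ x ∈ cap Ω ν l, ∀ h : ℝ, 0 < h → x + h • ν ∈ cap Ω ν l → u x < u (x + h • ν)) := by
  have hnt : Nontrivial (E N) := ⟨ν, 0, by rintro rfl; simp at hν⟩
  have D : MovingPlaneData s Ω f g ν (fun x => |u x|) :=
    ⟨hs0, hs1, hΩ.isOpen, hΩ.isBounded, hH1, hf_mono, hg_mono, hg_nonneg, hν, hf_refl, hu.abs,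
      hu_cont.abs, fun x => abs_nonneg _⟩
  intro l _ hl
  have hl0 : l ≤ 0 := hl.trans (min_le_left _ _)
  refine ⟨fun x hx hx0 => ?_, fun x hx h hh hxh => ?_⟩
  · have := D.le_reflect hl hx hx0
    rwa [hu.abs_eq (MovingPlaneData.ne_zero_of_mem_cap hl0 hx), hu.abs_eq hx0] at this
  · have hνν : inner ℝ ν ν = (1 : ℝ) := by rw [real_inner_self_eq_norm_sq, hν, one_pow]
    have hin : inner ℝ (x + h • ν) ν = inner ℝ x ν + h := by
      rw [inner_add_left, inner_smul_left, hνν]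
      simp
    have hlt := hxh.2
    rw [hin] at hlt
    -- The hyperplane halfway between the two points has level strictly below l, so the strict
    -- inequality applies even when l = λ₁⁰.
    have hrefl : reflect ν (inner ℝ x ν + h / 2) x = x + h • ν := by
      rw [reflect]
      congr 2
      ring
    have hne := MovingPlaneData.ne_zero_of_mem_cap hl0 hxh
    have := D.lt_reflect (l := inner ℝ x ν + h / 2) (by linarith) (x := x)
      ⟨hx.1, by linarith⟩ (by rwa [hrefl])
    rwa [hrefl, hu.abs_eq (MovingPlaneData.ne_zero_of_mem_cap hl0 hx), hu.abs_eq hne] at this
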